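/- Let $\mathcal C$ be a monoidal category which has coequalizers of reflexive pairs (parallel pairs with a common section), and suppose that for every object $A$ the functors $A\otimes(-)$ and $(-)\otimes A$ preserve them. Let $M$ be a commutative central monoid in $\mathcal C$, i.e. a commutative monoid in the Drinfeld center $\mathcal Z(\mathcal C)$, with unit $\mathrm{unit}\colon \mathbb 1\to M$, multiplication $\mathrm{mul}\colon M\otimes M\to M$ and half-braiding $\mathrm{swap}_A\colon M\otimes A\to A\otimes M$. Let $T_M=(-)\otimes M$ be the associated monad on $\mathcal C$, with the lax monoidal structure $\mathrm{lax}^{T_M}_0=\mathrm{unit}$ and $$\mathrm{lax}^{T_M}_{A,B}=(A\otimes B\otimes \mathrm{mul})(A\otimes \mathrm{swap}_B\otimes M)\colon A\otimes M\otimes B\otimes M\to A\otimes B\otimes M$$ (coherence isomorphisms of $\mathcal C$ are suppressed). Let $\mathrm{Mod}_{\mathcal C}(M)$ be its Eilenberg–Moore category, i.e. the category of right $M$-modules $(A,\mathrm{act}^A\colon A\otimes M\to A)$ in $\mathcal C$. It is monoidal with unit $M$ and tensor product $X\otimes_M Y$, for $X=(A,\mathrm{act}^A)$ and $Y=(B,\mathrm{act}^B)$,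 given by the coequalizer $\mathrm{quo}_{X,Y}\colon A\otimes B\to X\otimes_M Y$ of $\mathrm{act}^A\otimes B$ and $A\otimes(\mathrm{act}^B\,\mathrm{swap}_B)\colon A\otimes M\otimes B\to A\otimes B$, with the action induced by $\mathrm{act}^B$. A monoidal adjunction $G\dashv R$ is an adjunction between monoidal categories in which $G$ and $R$ are lax monoidal functors and the unit and counit are monoidal transformations. The projection formula holds for $R$ if the morphisms $A\otimes RX\to RGA\otimes RX\to R(GA\otimes X)$ and $RX\otimes A\to RX\otimes RGA\to R(X\otimes GA)$, composed of the unit of the adjunction and the lax structure of $R$, are isomorphisms for all $A$ and $X$. Consider the Eilenberg–Moore adjunction $\mathrm{Free}\dashv\mathrm{Forg}$, where $\mathrm{Free}\colon\mathcal C\to\mathrm{Mod}_{\mathcal C}(M)$, $A\mapsto (A\otimes M, A\otimes\mathrm{mul})$. Then: 1. $\mathrm{Free}$ is strong monoidal, with lax structure $\mathrm{lax}^{\mathrm{Free}}_{A,B}$ the unique factorization of $\mathrm{lax}^{T_M}_{A,B}$ through $\mathrm{quo}_{\mathrm{Free}A,\mathrm{Free}B}$ and $\mathrm{lax}^{\mathrm{Free}}_0$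 the canonical isomorphism $M\cong\mathbb 1\otimes M$; $\mathrm{Forg}$ is lax monoidal with $\mathrm{lax}^{\mathrm{Forg}}_{X,Y}=\mathrm{quo}_{X,Y}$ and $\mathrm{lax}_0^{\mathrm{Forg}}=\mathrm{unit}$; and with these structures $\mathrm{Free}\dashv\mathrm{Forg}$ is a monoidal adjunction. 2. The projection formula holds for $\mathrm{Forg}$. 3. Let $G\dashv R$, $G\colon\mathcal C\to\mathcal D$, be a monoidal adjunction with $RG=T_M$, as monads and as lax monoidal functors. Let $\tilde R\colon\mathcal D\to\mathrm{Mod}_{\mathcal C}(M)$ be the comparison functor, $\tilde R(X)=(R(X),\,R(\mathrm{counit}_X)\colon R(X)\otimes M=RGR(X)\to R(X))$, acting as $R$ on morphisms. Then every functor $K\colon\mathcal D\to\mathrm{Mod}_{\mathcal C}(M)$ with $\mathrm{Forg}\,K=R$ and $KG=\mathrm{Free}$ equals $\tilde R$, and there is a unique lax monoidal structure on $\tilde R$ such that $\mathrm{Forg}\,\tilde R=R$ and $\tilde R G=\mathrm{Free}$ hold strictly as equalities of lax monoidal functors. More generally, if instead of the equality an isomorphism $\varphi\colon T_M\cong RG$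 of monads which is a monoidal transformation is given, and $\tilde R(X)$ is $R(X)$ with the action $R(\mathrm{counit}_X)\,\varphi_{R(X)}$, then there is a unique lax monoidal structure on $\tilde R$ such that $\mathrm{Forg}\,\tilde R=R$ strictly as lax monoidal functors and the natural transformation $\mathrm{Free}\to\tilde R G$ with components $\varphi_A$ is monoidal. -/

import Mathlib

open CategoryTheory MonoidalCategory Limits
universe v₁ u₁ v₂ u₂
set_option linter.unusedSectionVars false

noncomputable section

namespace CentralMonoid
variable {C : Type u₁} [Category.{v₁} C] [MonoidalCategory C]

/-- The object of `C` underlying an object of the Drinfeld center. -/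
def ob (M : Center C) : C := M.1

/-- The unit `𝟙 ⟶ M` of a central monoid, as a morphism of `C`. -/
def one (M : Center C) [MonObj M] : 𝟙_ C ⟶ ob M := (MonObj.one (X := M)).f

/-- The multiplication `M ⊗ M ⟶ M` of a central monoid, as a morphism of `C`. -/
def mul (M : Center C) [MonObj M] : ob M ⊗ ob M ⟶ ob M := (MonObj.mul (X := M)).f

/-- The half-braiding `M ⊗ A ⟶ A ⊗ M`. -/
def swap (M : Center C) (A : C) : ob M ⊗ A ⟶ A ⊗ ob M := (M.2.β A).hom

variable (M : Center C)

theorem swap_naturality {A B : C} (f : A ⟶ B) :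
    ob M ◁ f ≫ swap M B = swap M A ≫ f ▷ ob M := M.2.naturality f

theorem swap_tensor (A B : C) : swap M (A ⊗ B) =
    (α_ (ob M) A B).inv ≫ swap M A ▷ B ≫ (α_ A (ob M) B).hom ≫ A ◁ swap M B ≫ (α_ A B (ob M)).inv :=
  M.2.monoidal A B

variable [MonObj M]

theorem mon_one_mul : one M ▷ ob M ≫ mul M = (λ_ (ob M)).hom :=
  congrArg Center.Hom.f (MonObj.one_mul M)

theorem mon_mul_one : ob M ◁ one M ≫ mul M = (ρ_ (ob M)).hom :=
  congrArg Center.Hom.f (MonObj.mul_one M)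

theorem mon_mul_assoc : mul M ▷ ob M ≫ mul M = (α_ (ob M) (ob M) (ob M)).hom ≫ ob M ◁ mul M ≫ mul M :=
  congrArg Center.Hom.f (MonObj.mul_assoc M)

theorem one_swap (A : C) : one M ▷ A ≫ swap M A = (λ_ A).hom ≫ (ρ_ A).inv ≫ A ◁ one M :=
  ((MonObj.one (X := M)).comm A).trans (Category.assoc _ _ _)

theorem mul_swap (A : C) : mul M ▷ A ≫ swap M A =
    (α_ (ob M) (ob M) A).hom ≫ ob M ◁ swap M A ≫ (α_ (ob M) A (ob M)).inv ≫ swap M A ▷ ob M ≫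
      (α_ A (ob M) (ob M)).hom ≫ A ◁ mul M := by
  have h := (MonObj.mul (X := M)).comm A
  refine h.trans ?_
  simp [Center.tensor_β, mul, swap, ob]


theorem swap_mul [IsCommMonObj M] : swap M (ob M) ≫ mul M = mul M :=
  congrArg Center.Hom.f (IsCommMonObj.mul_comm M)

/-- The monad `T_M = (-) ⊗ M` of a monoid `M`. -/
def tensorMonad : Monad C where
  toFunctor := tensorRight (ob M)
  η := { app := fun A => (ρ_ A).inv ≫ A ◁ one M
         naturality := fun A B f => by simp [whisker_exchange] }
  μ := { app := fun A => (α_ A (ob M) (ob M)).hom ≫ A ◁ mul M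
         naturality := fun A B f => by simp [whisker_exchange] }
  assoc A := by
    change ((α_ A (ob M) (ob M)).hom ≫ A ◁ mul M) ▷ ob M ≫ (α_ A (ob M) (ob M)).hom ≫ A ◁ mul M =
      ((α_ (A ⊗ ob M) (ob M) (ob M)).hom ≫ (A ⊗ ob M) ◁ mul M) ≫ (α_ A (ob M) (ob M)).hom ≫ A ◁ mul M
    calc _ = 𝟙 _ ⊗≫ A ◁ (mul M ▷ ob M ≫ mul M) := by monoidal
      _ = _ := by rw [mon_mul_assoc]; monoidal
  left_unit A := by
    change ((ρ_ (A ⊗ ob M)).inv ≫ (A ⊗ ob M) ◁ one M) ≫ (α_ A (ob M) (ob M)).hom ≫ A ◁ mul M = 𝟙 _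
    calc _ = 𝟙 _ ⊗≫ A ◁ (ob M ◁ one M ≫ mul M) := by monoidal
      _ = _ := by rw [mon_mul_one]; monoidal
  right_unit A := by
    change ((ρ_ A).inv ≫ A ◁ one M) ▷ ob M ≫ (α_ A (ob M) (ob M)).hom ≫ A ◁ mul M = 𝟙 _
    calc _ = 𝟙 _ ⊗≫ A ◁ (one M ▷ ob M ≫ mul M) := by monoidal
      _ = _ := by rw [mon_one_mul]; monoidal

/-- The category of right `M`-modules in `C`, i.e. the Eilenberg--Moore category of `T_M`: an
object is an object `X.A` of `C` with a unital and associative action `X.A ⊗ M ⟶ X.A`. -/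
abbrev RMod := (tensorMonad M).Algebra

variable {M}

/-- The right action `X ⊗ M ⟶ X` of a module. -/
def act (X : RMod M) : X.A ⊗ ob M ⟶ X.A := X.a

/-- The left action `M ⊗ X ⟶ X ⊗ M ⟶ X` obtained from the half-braiding. -/
def lact (X : RMod M) : ob M ⊗ X.A ⟶ X.A := swap M X.A ≫ act X

theorem act_one (X : RMod M) : X.A ◁ one M ≫ act X = (ρ_ X.A).hom := by
  have h : ((ρ_ X.A).inv ≫ X.A ◁ one M) ≫ act X = 𝟙 _ := X.unit
  rw [← cancel_epi (ρ_ X.A).inv, ← Category.assoc, h, Iso.inv_hom_id]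

theorem act_mul (X : RMod M) :
    act X ▷ ob M ≫ act X = (α_ X.A (ob M) (ob M)).hom ≫ X.A ◁ mul M ≫ act X := by
  have h : ((α_ X.A (ob M) (ob M)).hom ≫ X.A ◁ mul M) ≫ act X = act X ▷ ob M ≫ act X := X.assoc
  rw [← h, Category.assoc]

theorem hom_act {X Y : RMod M} (f : X ⟶ Y) : f.f ▷ ob M ≫ act Y = act X ≫ f.f := f.h

theorem hom_lact {X Y : RMod M} (f : X ⟶ Y) : ob M ◁ f.f ≫ lact Y = lact X ≫ f.f := by
  unfold lact
  rw [← Category.assoc, swap_naturality, Category.assoc, hom_act, Category.assoc]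

theorem lact_one (X : RMod M) : one M ▷ X.A ≫ lact X = (λ_ X.A).hom := by
  unfold lact
  rw [← Category.assoc, one_swap]
  simp [act_one]

variable (M) in
/-- The unit object: `M` acting on itself by multiplication. -/
def unitObj : RMod M where
  A := ob M
  a := mul M
  unit := by
    change ((ρ_ (ob M)).inv ≫ ob M ◁ one M) ≫ mul M = 𝟙 _
    rw [Category.assoc, mon_mul_one, Iso.inv_hom_id]
  assoc := by
    change ((α_ (ob M) (ob M) (ob M)).hom ≫ ob M ◁ mul M) ≫ mul M = mul M ▷ ob M ≫ mul M
    rw [mon_mul_assoc, Category.assoc]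

theorem act_unitObj : act (unitObj M) = mul M := rfl

section Comm

variable [IsCommMonObj M]

/-- The left action commutes with the right action. -/
theorem lact_act (X : RMod M) :
    lact X ▷ ob M ≫ act X = (α_ (ob M) X.A (ob M)).hom ≫ ob M ◁ act X ≫ lact X := by
  unfold lact
  have h1 : ob M ◁ act X ≫ swap M X.A = swap M (X.A ⊗ ob M) ≫ act X ▷ ob M := swap_naturality M _
  calc _ = swap M X.A ▷ ob M ≫ (act X ▷ ob M ≫ act X) := by simp
    _ = swap M X.A ▷ ob M ≫ (α_ X.A (ob M) (ob M)).hom ≫ X.A ◁ mul M ≫ act X := by rw [act_mul]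
    _ = swap M X.A ▷ ob M ≫ (α_ X.A (ob M) (ob M)).hom ≫ X.A ◁ (swap M (ob M) ≫ mul M) ≫ act X := by
      rw [swap_mul]
    _ = (α_ (ob M) X.A (ob M)).hom ≫ swap M (X.A ⊗ ob M) ≫
        ((α_ X.A (ob M) (ob M)).hom ≫ X.A ◁ mul M ≫ act X) := by rw [swap_tensor]; simp
    _ = (α_ (ob M) X.A (ob M)).hom ≫ swap M (X.A ⊗ ob M) ≫ act X ▷ ob M ≫ act X := by rw [act_mul]
    _ = _ := by rw [← Category.assoc (swap M (X.A ⊗ ob M)), ← h1, Category.assoc]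

theorem lact_mul (X : RMod M) :
    mul M ▷ X.A ≫ lact X = (α_ (ob M) (ob M) X.A).hom ≫ ob M ◁ lact X ≫ lact X := by
  have h := lact_act X
  calc _ = (mul M ▷ X.A ≫ swap M X.A) ≫ act X := by simp [lact]
    _ = (α_ (ob M) (ob M) X.A).hom ≫ ob M ◁ swap M X.A ≫ (α_ (ob M) X.A (ob M)).inv ≫ swap M X.A ▷ ob M ≫
          ((α_ X.A (ob M) (ob M)).hom ≫ X.A ◁ mul M ≫ act X) := by rw [mul_swap]; simp
    _ = (α_ (ob M) (ob M) X.A).hom ≫ ob M ◁ swap M X.A ≫ (α_ (ob M) X.A (ob M)).inv ≫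
          (lact X ▷ ob M ≫ act X) := by rw [← act_mul]; simp [lact]
    _ = _ := by rw [h]; simp [lact]


theorem lact_unitObj : lact (unitObj M) = mul M := swap_mul M

variable (M)

theorem swap_unit : swap M (𝟙_ C) ≫ (λ_ (ob M)).hom = (ρ_ (ob M)).hom := by
  rw [← mon_one_mul, ← Category.assoc, ← swap_naturality, Category.assoc, swap_mul, mon_mul_one]

/-- The morphism `M ⊗ B ⊗ M ⟶ B ⊗ M ⊗ M ⟶ B ⊗ M`. -/
def swapMul (B : C) : ob M ⊗ (B ⊗ ob M) ⟶ B ⊗ ob M :=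
  (α_ (ob M) B (ob M)).inv ≫ swap M B ▷ ob M ≫ (α_ B (ob M) (ob M)).hom ≫ B ◁ mul M

theorem lact_free (B : C) : lact ((tensorMonad M).free.obj B) = swapMul M B := by
  change swap M (B ⊗ ob M) ≫ (α_ B (ob M) (ob M)).hom ≫ B ◁ mul M = _
  rw [swap_tensor]
  calc _ = (α_ (ob M) B (ob M)).inv ≫ swap M B ▷ ob M ≫ (α_ B (ob M) (ob M)).hom ≫
        B ◁ (swap M (ob M) ≫ mul M) := by simp
    _ = _ := by rw [swap_mul]; rfl

theorem one_swapMul (B : C) : one M ▷ (B ⊗ ob M) ≫ swapMul M B = (λ_ (B ⊗ ob M)).hom := by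
  rw [← lact_free]; exact lact_one ((tensorMonad M).free.obj B)

theorem mul_swapMul (B : C) : mul M ▷ (B ⊗ ob M) ≫ swapMul M B =
    (α_ (ob M) (ob M) (B ⊗ ob M)).hom ≫ ob M ◁ swapMul M B ≫ swapMul M B := by
  rw [← lact_free]; exact lact_mul ((tensorMonad M).free.obj B)

theorem swapMul_naturality {A B : C} (f : A ⟶ B) :
    ob M ◁ f ▷ ob M ≫ swapMul M B = swapMul M A ≫ f ▷ ob M := by
  unfold swapMul
  calc _ = (α_ (ob M) A (ob M)).inv ≫ (ob M ◁ f ≫ swap M B) ▷ ob M ≫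
        (α_ B (ob M) (ob M)).hom ≫ B ◁ mul M := by monoidal
    _ = (α_ (ob M) A (ob M)).inv ≫ swap M A ▷ ob M ≫ (α_ A (ob M) (ob M)).hom ≫
        f ▷ (ob M ⊗ ob M) ≫ B ◁ mul M := by rw [swap_naturality]; monoidal
    _ = _ := by rw [← whisker_exchange]; simp only [Category.assoc]

theorem swapMul_tensor (A B : C) : swapMul M (A ⊗ B) =
    ob M ◁ (α_ A B (ob M)).hom ≫ (α_ (ob M) A (B ⊗ ob M)).inv ≫ swap M A ▷ (B ⊗ ob M) ≫
      (α_ A (ob M) (B ⊗ ob M)).hom ≫ A ◁ swapMul M B ≫ (α_ A B (ob M)).inv := by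
  unfold swapMul
  rw [swap_tensor]
  monoidal

/-- The morphism `A ⊗ M ⊗ B ⊗ M ⟶ A ⊗ B ⊗ M`, given by moving the first factor `M` past `B` with
the half-braiding and then multiplying. -/
def laxT (A B : C) : (A ⊗ ob M) ⊗ (B ⊗ ob M) ⟶ (A ⊗ B) ⊗ ob M :=
  (α_ A (ob M) (B ⊗ ob M)).hom ≫ A ◁ swapMul M B ≫ (α_ A B (ob M)).inv

/-- The lax monoidal structure of `T_M`. -/
instance : (tensorMonad M).toFunctor.LaxMonoidal where
  ε := one M ≫ (λ_ (ob M)).inv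
  μ A B := laxT M A B
  μ_natural_left {A B} f X := by
    change f ▷ ob M ▷ (X ⊗ ob M) ≫ laxT M B X = laxT M A X ≫ f ▷ X ▷ ob M
    unfold laxT
    calc _ = (α_ _ _ _).hom ≫ (f ▷ (ob M ⊗ X ⊗ ob M) ≫ B ◁ swapMul M X) ≫ (α_ _ _ _).inv := by
          monoidal
      _ = _ := by rw [← whisker_exchange]; monoidal
  μ_natural_right {A B} X f := by
    change (X ⊗ ob M) ◁ f ▷ ob M ≫ laxT M X B = laxT M X A ≫ (X ◁ f) ▷ ob M
    unfold laxT
    calc _ = (α_ _ _ _).hom ≫ X ◁ (ob M ◁ f ▷ ob M ≫ swapMul M B) ≫ (α_ _ _ _).inv := by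
          monoidal
      _ = _ := by rw [swapMul_naturality]; monoidal
  associativity X Y Z := by
    change laxT M X Y ▷ (Z ⊗ ob M) ≫ laxT M (X ⊗ Y) Z ≫ (α_ X Y Z).hom ▷ ob M =
      (α_ (X ⊗ ob M) (Y ⊗ ob M) (Z ⊗ ob M)).hom ≫ (X ⊗ ob M) ◁ laxT M Y Z ≫ laxT M X (Y ⊗ Z)
    unfold laxT
    calc _ = 𝟙 _ ⊗≫ X ◁ swapMul M Y ▷ (Z ⊗ ob M) ⊗≫ X ◁ Y ◁ swapMul M Z ⊗≫ 𝟙 _ := by monoidal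
      _ = 𝟙 _ ⊗≫ X ◁ swap M Y ▷ (ob M ⊗ (Z ⊗ ob M)) ⊗≫
          X ◁ Y ◁ (mul M ▷ (Z ⊗ ob M) ≫ swapMul M Z) ⊗≫ 𝟙 _ := by
        rw [swapMul]; monoidal
      _ = 𝟙 _ ⊗≫ X ◁ (swap M Y ▷ (ob M ⊗ (Z ⊗ ob M)) ≫ (Y ⊗ ob M) ◁ swapMul M Z) ⊗≫
          X ◁ Y ◁ swapMul M Z ⊗≫ 𝟙 _ := by
        rw [mul_swapMul]; monoidal
      _ = _ := by rw [← whisker_exchange, swapMul_tensor]; monoidal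
  left_unitality X := by
    change (λ_ (X ⊗ ob M)).hom = (one M ≫ (λ_ (ob M)).inv) ▷ (X ⊗ ob M) ≫ laxT M (𝟙_ C) X ≫
      (λ_ X).hom ▷ ob M
    unfold laxT
    symm
    calc _ = 𝟙 _ ⊗≫ (one M ▷ (X ⊗ ob M) ≫ swapMul M X) := by monoidal
      _ = _ := by rw [one_swapMul]; monoidal
  right_unitality X := by
    change (ρ_ (X ⊗ ob M)).hom = (X ⊗ ob M) ◁ (one M ≫ (λ_ (ob M)).inv) ≫ laxT M X (𝟙_ C) ≫
      (ρ_ X).hom ▷ ob M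
    unfold laxT swapMul
    symm
    calc _ = 𝟙 _ ⊗≫ X ◁ (ob M ◁ one M ⊗≫
          (swap M (𝟙_ C) ≫ (λ_ (ob M)).hom) ▷ ob M ≫ mul M) := by monoidal
      _ = 𝟙 _ ⊗≫ X ◁ (ob M ◁ one M ≫ mul M) := by rw [swap_unit]; monoidal
      _ = _ := by rw [mon_mul_one]; monoidal

variable {M}

end Comm

section Tensor

variable [HasReflexiveCoequalizers C]

/-- `X ⊗ M ⊗ Y ⟶ X ⊗ Y`, acting on `X`. -/
abbrev pairL (X Y : RMod M) : (X.A ⊗ ob M) ⊗ Y.A ⟶ X.A ⊗ Y.A := act X ▷ Y.A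

/-- `X ⊗ M ⊗ Y ⟶ X ⊗ Y`, acting on `Y` through the half-braiding. -/
abbrev pairR (X Y : RMod M) : (X.A ⊗ ob M) ⊗ Y.A ⟶ X.A ⊗ Y.A :=
  (α_ X.A (ob M) Y.A).hom ≫ X.A ◁ lact Y

instance (X Y : RMod M) : IsReflexivePair (pairL X Y) (pairR X Y) :=
  IsReflexivePair.mk' (((ρ_ X.A).inv ≫ X.A ◁ one M) ▷ Y.A)
    (by rw [← comp_whiskerRight, Category.assoc, act_one]; simp)
    (by
      calc _ = 𝟙 _ ⊗≫ X.A ◁ (one M ▷ Y.A ≫ lact Y) := by monoidal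
        _ = _ := by rw [lact_one]; monoidal)

/-- The object of `C` underlying `X ⊗_M Y`. -/
def modTensorObj (X Y : RMod M) : C := coequalizer (pairL X Y) (pairR X Y)

/-- The quotient morphism `X ⊗ Y ⟶ X ⊗_M Y`. -/
def quoA (X Y : RMod M) : X.A ⊗ Y.A ⟶ modTensorObj X Y := coequalizer.π (pairL X Y) (pairR X Y)

theorem quoA_condition (X Y : RMod M) :
    act X ▷ Y.A ≫ quoA X Y = (α_ X.A (ob M) Y.A).hom ≫ X.A ◁ lact Y ≫ quoA X Y :=
  (coequalizer.condition (pairL X Y) (pairR X Y)).trans (Category.assoc _ _ _)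

instance (X Y : RMod M) : Epi (quoA X Y) := inferInstanceAs (Epi (coequalizer.π _ _))

/-- The morphism out of `X ⊗_M Y` induced by a balanced morphism. -/
def descA {X Y : RMod M} {Z : C} (h : X.A ⊗ Y.A ⟶ Z)
    (w : act X ▷ Y.A ≫ h = (α_ X.A (ob M) Y.A).hom ≫ X.A ◁ lact Y ≫ h) : modTensorObj X Y ⟶ Z :=
  coequalizer.desc h (w.trans (Category.assoc _ _ _).symm)

theorem quoA_descA {X Y : RMod M} {Z : C} (h : X.A ⊗ Y.A ⟶ Z)
    (w : act X ▷ Y.A ≫ h = (α_ X.A (ob M) Y.A).hom ≫ X.A ◁ lact Y ≫ h) :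
    quoA X Y ≫ descA h w = h := coequalizer.π_desc _ _

variable [∀ A : C, Monad.PreservesColimitOfIsReflexivePair (tensorRight A)]

/-- `(X ⊗_M Y) ⊗ W` is again a coequalizer. -/
def isColimitR (X Y : RMod M) (W : C) :
    IsColimit (Cofork.ofπ (f := pairL X Y ▷ W) (g := pairR X Y ▷ W) (quoA X Y ▷ W)
      (by rw [← comp_whiskerRight, ← comp_whiskerRight]; exact
            congrArg (· ▷ W) (coequalizer.condition (pairL X Y) (pairR X Y)))) :=
  isColimitOfHasCoequalizerOfPreservesColimit (tensorRight W) (pairL X Y) (pairR X Y)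

instance (X Y : RMod M) (W : C) : Epi (quoA X Y ▷ W) :=
  Cofork.IsColimit.epi (isColimitR X Y W)

/-- The morphism out of `(X ⊗_M Y) ⊗ W` induced by a balanced morphism. -/
def descRA {X Y : RMod M} {W Z : C} (h : (X.A ⊗ Y.A) ⊗ W ⟶ Z)
    (w : act X ▷ Y.A ▷ W ≫ h = (α_ X.A (ob M) Y.A).hom ▷ W ≫ (X.A ◁ lact Y) ▷ W ≫ h) :
    modTensorObj X Y ⊗ W ⟶ Z :=
  Cofork.IsColimit.desc (isColimitR X Y W) h
    (w.trans (by rw [comp_whiskerRight, Category.assoc]))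

theorem quoA_descRA {X Y : RMod M} {W Z : C} (h : (X.A ⊗ Y.A) ⊗ W ⟶ Z)
    (w : act X ▷ Y.A ▷ W ≫ h = (α_ X.A (ob M) Y.A).hom ▷ W ≫ (X.A ◁ lact Y) ▷ W ≫ h) :
    quoA X Y ▷ W ≫ descRA h w = h :=
  Cofork.IsColimit.π_desc' (isColimitR X Y W) _ _

variable [∀ A : C, Monad.PreservesColimitOfIsReflexivePair (tensorLeft A)]

/-- `W ⊗ (X ⊗_M Y)` is again a coequalizer. -/
def isColimitL (X Y : RMod M) (W : C) :
    IsColimit (Cofork.ofπ (f := W ◁ pairL X Y) (g := W ◁ pairR X Y) (W ◁ quoA X Y)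
      (by rw [← whiskerLeft_comp, ← whiskerLeft_comp]; exact
            congrArg (W ◁ ·) (coequalizer.condition (pairL X Y) (pairR X Y)))) :=
  isColimitOfHasCoequalizerOfPreservesColimit (tensorLeft W) (pairL X Y) (pairR X Y)

instance (X Y : RMod M) (W : C) : Epi (W ◁ quoA X Y) :=
  Cofork.IsColimit.epi (isColimitL X Y W)

/-- The morphism out of `W ⊗ (X ⊗_M Y)` induced by a balanced morphism. -/
def descLA {X Y : RMod M} {W Z : C} (h : W ⊗ (X.A ⊗ Y.A) ⟶ Z)
    (w : W ◁ act X ▷ Y.A ≫ h = W ◁ (α_ X.A (ob M) Y.A).hom ≫ W ◁ X.A ◁ lact Y ≫ h) :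
    W ⊗ modTensorObj X Y ⟶ Z :=
  Cofork.IsColimit.desc (isColimitL X Y W) h
    (w.trans (by rw [whiskerLeft_comp, Category.assoc]))

theorem quoA_descLA {X Y : RMod M} {W Z : C} (h : W ⊗ (X.A ⊗ Y.A) ⟶ Z)
    (w : W ◁ act X ▷ Y.A ≫ h = W ◁ (α_ X.A (ob M) Y.A).hom ≫ W ◁ X.A ◁ lact Y ≫ h) :
    W ◁ quoA X Y ≫ descLA h w = h :=
  Cofork.IsColimit.π_desc' (isColimitL X Y W) _ _

instance (X Y : RMod M) (W W' : C) : Epi (quoA X Y ▷ W ▷ W') := by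
  have h : quoA X Y ▷ W ▷ W' = (α_ _ _ _).hom ≫ quoA X Y ▷ (W ⊗ W') ≫ (α_ _ _ _).inv := by monoidal
  rw [h]; infer_instance

instance (X Y : RMod M) (W W' : C) : Epi (W ◁ quoA X Y ▷ W') := by
  obtain ⟨s, h₁, h₂⟩ := (inferInstance : IsReflexivePair (pairL X Y) (pairR X Y)).common_section
  have : IsReflexivePair (pairL X Y ▷ W') (pairR X Y ▷ W') :=
    IsReflexivePair.mk' (s ▷ W') (by rw [← comp_whiskerRight, h₁, id_whiskerRight])
      (by rw [← comp_whiskerRight, h₂, id_whiskerRight])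
  exact Cofork.IsColimit.epi (isColimitCoforkMapOfIsColimit (tensorLeft W) _ (isColimitR X Y W'))

instance (X Y : RMod M) (W W' : C) : Epi ((W ◁ quoA X Y) ▷ W') := by
  have h : (W ◁ quoA X Y) ▷ W' =
    (α_ _ _ _).hom ≫ W ◁ quoA X Y ▷ W' ≫ (α_ _ _ _).inv := by monoidal
  rw [h]; infer_instance

instance (X Y : RMod M) (W W' : C) : Epi (W ◁ W' ◁ quoA X Y) := by
  have h : W ◁ W' ◁ quoA X Y = (α_ _ _ _).inv ≫ (W ⊗ W') ◁ quoA X Y ≫ (α_ _ _ _).hom := by monoidal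
  rw [h]; infer_instance

variable [IsCommMonObj M]

/-- The action of `M` on `X ⊗_M Y`, induced by the one on `Y`. -/
def tensorAct (X Y : RMod M) : modTensorObj X Y ⊗ ob M ⟶ modTensorObj X Y :=
  descRA (W := ob M) ((α_ X.A Y.A (ob M)).hom ≫ X.A ◁ act Y ≫ quoA X Y) (by
    have h := lact_act Y
    calc _ = 𝟙 _ ⊗≫ (act X ▷ (Y.A ⊗ ob M) ≫ X.A ◁ act Y) ≫ quoA X Y := by monoidal
      _ = 𝟙 _ ⊗≫ (X.A ⊗ ob M) ◁ act Y ≫ (act X ▷ Y.A ≫ quoA X Y) := by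
        rw [← whisker_exchange]; monoidal
      _ = 𝟙 _ ⊗≫ X.A ◁ ((α_ _ _ _).hom ≫ ob M ◁ act Y ≫ lact Y) ≫ quoA X Y := by
        rw [quoA_condition]; monoidal
      _ = _ := by rw [← h]; monoidal)

theorem quo_tensorAct (X Y : RMod M) : quoA X Y ▷ ob M ≫ tensorAct X Y =
    (α_ X.A Y.A (ob M)).hom ≫ X.A ◁ act Y ≫ quoA X Y := quoA_descRA _ _

/-- The module `X ⊗_M Y`. -/
def modTensor (X Y : RMod M) : RMod M where
  A := modTensorObj X Y
  a := tensorAct X Y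
  unit := by
    change ((ρ_ (modTensorObj X Y)).inv ≫ modTensorObj X Y ◁ one M) ≫ tensorAct X Y = 𝟙 _
    rw [← cancel_epi (quoA X Y)]
    calc _ = (ρ_ _).inv ≫ (quoA X Y ▷ 𝟙_ C ≫ modTensorObj X Y ◁ one M) ≫ tensorAct X Y := by
          monoidal
      _ = (ρ_ _).inv ≫ (X.A ⊗ Y.A) ◁ one M ≫ quoA X Y ▷ ob M ≫ tensorAct X Y := by
          rw [← whisker_exchange, Category.assoc]
      _ = 𝟙 _ ⊗≫ X.A ◁ (Y.A ◁ one M ≫ act Y) ≫ quoA X Y := by rw [quo_tensorAct]; monoidal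
      _ = _ := by rw [act_one]; monoidal
  assoc := by
    change ((α_ (modTensorObj X Y) (ob M) (ob M)).hom ≫ modTensorObj X Y ◁ mul M) ≫ tensorAct X Y =
      tensorAct X Y ▷ ob M ≫ tensorAct X Y
    rw [← cancel_epi (quoA X Y ▷ ob M ▷ ob M)]
    calc _ = (α_ _ _ _).hom ≫ (quoA X Y ▷ (ob M ⊗ ob M) ≫ modTensorObj X Y ◁ mul M) ≫
            tensorAct X Y := by monoidal
      _ = (α_ _ _ _).hom ≫ (X.A ⊗ Y.A) ◁ mul M ≫ quoA X Y ▷ ob M ≫ tensorAct X Y := by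
          rw [← whisker_exchange, Category.assoc]
      _ = 𝟙 _ ⊗≫ X.A ◁ ((α_ _ _ _).hom ≫ Y.A ◁ mul M ≫ act Y) ≫ quoA X Y := by
          rw [quo_tensorAct]; monoidal
      _ = 𝟙 _ ⊗≫ (X.A ◁ act Y) ▷ ob M ⊗≫ X.A ◁ act Y ≫ quoA X Y := by rw [← act_mul]; monoidal
      _ = ((α_ _ _ _).hom ≫ X.A ◁ act Y) ▷ ob M ≫ quoA X Y ▷ ob M ≫ tensorAct X Y := by
          rw [quo_tensorAct]; monoidal
      _ = (quoA X Y ▷ ob M ≫ tensorAct X Y) ▷ ob M ≫ tensorAct X Y := by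
          rw [quo_tensorAct]; simp only [comp_whiskerRight, Category.assoc]; rw [quo_tensorAct]
      _ = _ := by simp only [comp_whiskerRight, Category.assoc]

/-- The quotient morphism `X ⊗ Y ⟶ X ⊗_M Y`, the coequalizer of the two actions of `M`. -/
def quo (X Y : RMod M) : X.A ⊗ Y.A ⟶ (modTensor X Y).A := quoA X Y

theorem quo_condition (X Y : RMod M) :
    act X ▷ Y.A ≫ quo X Y = (α_ X.A (ob M) Y.A).hom ≫ X.A ◁ lact Y ≫ quo X Y :=
  quoA_condition X Y

instance (X Y : RMod M) : Epi (quo X Y) := inferInstanceAs (Epi (quoA X Y))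
instance (X Y : RMod M) (W : C) : Epi (quo X Y ▷ W) := inferInstanceAs (Epi (quoA X Y ▷ W))
instance (X Y : RMod M) (W : C) : Epi (W ◁ quo X Y) := inferInstanceAs (Epi (W ◁ quoA X Y))
instance (X Y : RMod M) (W W' : C) : Epi (quo X Y ▷ W ▷ W') :=
  inferInstanceAs (Epi (quoA X Y ▷ W ▷ W'))
instance (X Y : RMod M) (W W' : C) : Epi (W ◁ quo X Y ▷ W') :=
  inferInstanceAs (Epi (W ◁ quoA X Y ▷ W'))
instance (X Y : RMod M) (W W' : C) : Epi ((W ◁ quo X Y) ▷ W') :=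
  inferInstanceAs (Epi ((W ◁ quoA X Y) ▷ W'))
instance (X Y : RMod M) (W W' : C) : Epi (W ◁ W' ◁ quo X Y) :=
  inferInstanceAs (Epi (W ◁ W' ◁ quoA X Y))

/-- The morphism out of `X ⊗_M Y` induced by a balanced morphism. -/
def desc {X Y : RMod M} {Z : C} (h : X.A ⊗ Y.A ⟶ Z)
    (w : act X ▷ Y.A ≫ h = (α_ X.A (ob M) Y.A).hom ≫ X.A ◁ lact Y ≫ h) :
    (modTensor X Y).A ⟶ Z := descA h w

theorem quo_desc {X Y : RMod M} {Z : C} (h : X.A ⊗ Y.A ⟶ Z)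
    (w : act X ▷ Y.A ≫ h = (α_ X.A (ob M) Y.A).hom ≫ X.A ◁ lact Y ≫ h) :
    quo X Y ≫ desc h w = h := quoA_descA h w

/-- The morphism out of `(X ⊗_M Y) ⊗ W` induced by a balanced morphism. -/
def descR {X Y : RMod M} {W Z : C} (h : (X.A ⊗ Y.A) ⊗ W ⟶ Z)
    (w : act X ▷ Y.A ▷ W ≫ h = (α_ X.A (ob M) Y.A).hom ▷ W ≫ (X.A ◁ lact Y) ▷ W ≫ h) :
    (modTensor X Y).A ⊗ W ⟶ Z := descRA h w

theorem quo_descR {X Y : RMod M} {W Z : C} (h : (X.A ⊗ Y.A) ⊗ W ⟶ Z)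
    (w : act X ▷ Y.A ▷ W ≫ h = (α_ X.A (ob M) Y.A).hom ▷ W ≫ (X.A ◁ lact Y) ▷ W ≫ h) :
    quo X Y ▷ W ≫ descR h w = h := quoA_descRA h w

/-- The morphism out of `W ⊗ (X ⊗_M Y)` induced by a balanced morphism. -/
def descL {X Y : RMod M} {W Z : C} (h : W ⊗ (X.A ⊗ Y.A) ⟶ Z)
    (w : W ◁ act X ▷ Y.A ≫ h = W ◁ (α_ X.A (ob M) Y.A).hom ≫ W ◁ X.A ◁ lact Y ≫ h) :
    W ⊗ (modTensor X Y).A ⟶ Z := descLA h w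

theorem quo_descL {X Y : RMod M} {W Z : C} (h : W ⊗ (X.A ⊗ Y.A) ⟶ Z)
    (w : W ◁ act X ▷ Y.A ≫ h = W ◁ (α_ X.A (ob M) Y.A).hom ≫ W ◁ X.A ◁ lact Y ≫ h) :
    W ◁ quo X Y ≫ descL h w = h := quoA_descLA h w

theorem quo_act (X Y : RMod M) : quo X Y ▷ ob M ≫ act (modTensor X Y) =
    (α_ X.A Y.A (ob M)).hom ≫ X.A ◁ act Y ≫ quo X Y := quo_tensorAct X Y

theorem quo_lact (X Y : RMod M) : ob M ◁ quo X Y ≫ lact (modTensor X Y) =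
    (α_ (ob M) X.A Y.A).inv ≫ lact X ▷ Y.A ≫ quo X Y := by
  calc _ = (ob M ◁ quo X Y ≫ swap M _) ≫ act (modTensor X Y) := (Category.assoc _ _ _).symm
    _ = swap M (X.A ⊗ Y.A) ≫ quo X Y ▷ ob M ≫ act (modTensor X Y) := by
      rw [swap_naturality, Category.assoc]
    _ = (α_ (ob M) X.A Y.A).inv ≫ swap M X.A ▷ Y.A ≫
        ((α_ X.A (ob M) Y.A).hom ≫ X.A ◁ lact Y ≫ quo X Y) := by
      rw [quo_act, swap_tensor]; simp [lact]
    _ = _ := by rw [← quo_condition]; simp [lact]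

/-- Two morphisms of modules out of `X ⊗_M Y` agree if they agree on `X ⊗ Y`. -/
theorem tensor_hom_ext {X Y Z : RMod M} {f g : modTensor X Y ⟶ Z}
    (h : quo X Y ≫ f.f = quo X Y ≫ g.f) : f = g := by
  ext
  exact (cancel_epi (quo X Y)).1 h

/-- A morphism of modules out of `X ⊗_M Y`, from a balanced and `M`-linear morphism. -/
def descHom {X Y Z : RMod M} (h : X.A ⊗ Y.A ⟶ Z.A)
    (w : act X ▷ Y.A ≫ h = (α_ X.A (ob M) Y.A).hom ≫ X.A ◁ lact Y ≫ h)
    (hlin : h ▷ ob M ≫ act Z = (α_ X.A Y.A (ob M)).hom ≫ X.A ◁ act Y ≫ h) :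
    modTensor X Y ⟶ Z where
  f := desc h w
  h := by
    change desc h w ▷ ob M ≫ act Z = act (modTensor X Y) ≫ desc h w
    rw [← cancel_epi (quo X Y ▷ ob M), ← Category.assoc, ← comp_whiskerRight, quo_desc, hlin,
      ← Category.assoc (quo X Y ▷ ob M), quo_act, Category.assoc, Category.assoc, quo_desc]

theorem quo_descHom {X Y Z : RMod M} (h : X.A ⊗ Y.A ⟶ Z.A)
    (w : act X ▷ Y.A ≫ h = (α_ X.A (ob M) Y.A).hom ≫ X.A ◁ lact Y ≫ h)
    (hlin : h ▷ ob M ≫ act Z = (α_ X.A Y.A (ob M)).hom ≫ X.A ◁ act Y ≫ h) :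
    quo X Y ≫ (descHom h w hlin).f = h := quo_desc h w

/-- `X ⊗_M f`. -/
def whiskerL (X : RMod M) {Y Z : RMod M} (f : Y ⟶ Z) : modTensor X Y ⟶ modTensor X Z :=
  descHom (Z := modTensor X Z) (X.A ◁ f.f ≫ quo X Z)
    (by
      rw [← whisker_exchange_assoc, quo_condition]
      simp only [tensor_whiskerLeft, Category.assoc, Iso.inv_hom_id_assoc]
      rw [← whiskerLeft_comp_assoc, hom_lact, whiskerLeft_comp_assoc])
    (by
      rw [comp_whiskerRight, Category.assoc, quo_act]
      rw [associator_naturality_middle_assoc, ← whiskerLeft_comp_assoc, hom_act,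
        whiskerLeft_comp_assoc])

theorem quo_whiskerL (X : RMod M) {Y Z : RMod M} (f : Y ⟶ Z) :
    quo X Y ≫ (whiskerL X f).f = X.A ◁ f.f ≫ quo X Z := quo_descHom _ _ _

/-- `f ⊗_M Y`. -/
def whiskerR {X Z : RMod M} (f : X ⟶ Z) (Y : RMod M) : modTensor X Y ⟶ modTensor Z Y :=
  descHom (Z := modTensor Z Y) (f.f ▷ Y.A ≫ quo Z Y)
    (by
      rw [← comp_whiskerRight_assoc, ← hom_act, comp_whiskerRight, Category.assoc, quo_condition]
      simp [whisker_exchange_assoc])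
    (by
      rw [comp_whiskerRight, Category.assoc, quo_act]
      simp [whisker_exchange_assoc])

theorem quo_whiskerR {X Z : RMod M} (f : X ⟶ Z) (Y : RMod M) :
    quo X Y ≫ (whiskerR f Y).f = f.f ▷ Y.A ≫ quo Z Y := quo_descHom _ _ _

/-- Auxiliary morphism for the associator. -/
def assocAux (X Y Z : RMod M) :
    (modTensor X Y).A ⊗ Z.A ⟶ (modTensor X (modTensor Y Z)).A :=
  descR ((α_ X.A Y.A Z.A).hom ≫ X.A ◁ quo Y Z ≫ quo X (modTensor Y Z)) (by
    calc _ = 𝟙 _ ⊗≫ (act X ▷ (Y.A ⊗ Z.A) ≫ X.A ◁ quo Y Z) ≫ quo X (modTensor Y Z) := by monoidal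
      _ = 𝟙 _ ⊗≫ (X.A ⊗ ob M) ◁ quo Y Z ≫
            (act X ▷ (modTensor Y Z).A ≫ quo X (modTensor Y Z)) := by
        rw [← whisker_exchange]; monoidal
      _ = 𝟙 _ ⊗≫ X.A ◁ (ob M ◁ quo Y Z ≫ lact (modTensor Y Z)) ≫ quo X (modTensor Y Z) := by
        rw [quo_condition]; monoidal
      _ = _ := by rw [quo_lact]; monoidal)

theorem quo_assocAux (X Y Z : RMod M) : quo X Y ▷ Z.A ≫ assocAux X Y Z =
    (α_ X.A Y.A Z.A).hom ≫ X.A ◁ quo Y Z ≫ quo X (modTensor Y Z) := quo_descR _ _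

/-- The morphism `(X ⊗_M Y) ⊗_M Z ⟶ X ⊗_M (Y ⊗_M Z)` induced by the associator of `C`. -/
def assocHom (X Y Z : RMod M) :
    modTensor (modTensor X Y) Z ⟶ modTensor X (modTensor Y Z) :=
  descHom (assocAux X Y Z)
    (by
      rw [← cancel_epi (quo X Y ▷ ob M ▷ Z.A)]
      calc _ = (quo X Y ▷ ob M ≫ act (modTensor X Y)) ▷ Z.A ≫ assocAux X Y Z := by monoidal
        _ = ((α_ X.A Y.A (ob M)).hom ≫ X.A ◁ act Y) ▷ Z.A ≫ (quo X Y ▷ Z.A ≫ assocAux X Y Z) := by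
          rw [quo_act]; monoidal
        _ = 𝟙 _ ⊗≫ X.A ◁ (act Y ▷ Z.A ≫ quo Y Z) ≫ quo X (modTensor Y Z) := by
          rw [quo_assocAux]; monoidal
        _ = (α_ _ _ _).hom ≫ (X.A ⊗ Y.A) ◁ lact Z ≫
              ((α_ X.A Y.A Z.A).hom ≫ X.A ◁ quo Y Z ≫ quo X (modTensor Y Z)) := by
          rw [quo_condition]; monoidal
        _ = (α_ _ _ _).hom ≫ ((X.A ⊗ Y.A) ◁ lact Z ≫ quo X Y ▷ Z.A) ≫ assocAux X Y Z := by
          rw [← quo_assocAux, Category.assoc]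
        _ = _ := by rw [whisker_exchange]; monoidal)
    (by
      rw [← cancel_epi (quo X Y ▷ Z.A ▷ ob M)]
      calc _ = (quo X Y ▷ Z.A ≫ assocAux X Y Z) ▷ ob M ≫ act (modTensor X (modTensor Y Z)) := by
            monoidal
        _ = ((α_ X.A Y.A Z.A).hom ≫ X.A ◁ quo Y Z) ▷ ob M ≫
              (quo X (modTensor Y Z) ▷ ob M ≫ act (modTensor X (modTensor Y Z))) := by
          rw [quo_assocAux]; monoidal
        _ = 𝟙 _ ⊗≫ X.A ◁ (quo Y Z ▷ ob M ≫ act (modTensor Y Z)) ≫ quo X (modTensor Y Z) := by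
          rw [quo_act]; monoidal
        _ = (α_ _ _ _).hom ≫ (X.A ⊗ Y.A) ◁ act Z ≫
              ((α_ X.A Y.A Z.A).hom ≫ X.A ◁ quo Y Z ≫ quo X (modTensor Y Z)) := by
          rw [quo_act]; monoidal
        _ = (α_ _ _ _).hom ≫ ((X.A ⊗ Y.A) ◁ act Z ≫ quo X Y ▷ Z.A) ≫ assocAux X Y Z := by
          rw [← quo_assocAux, Category.assoc]
        _ = _ := by rw [whisker_exchange]; monoidal)

theorem quo_assocHom (X Y Z : RMod M) :
    quo X Y ▷ Z.A ≫ quo (modTensor X Y) Z ≫ (assocHom X Y Z).f =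
      (α_ X.A Y.A Z.A).hom ≫ X.A ◁ quo Y Z ≫ quo X (modTensor Y Z) := by
  unfold assocHom
  rw [quo_descHom, quo_assocAux]

/-- Auxiliary morphism for the inverse of the associator. -/
def assocInvAux (X Y Z : RMod M) :
    X.A ⊗ (modTensor Y Z).A ⟶ (modTensor (modTensor X Y) Z).A :=
  descL ((α_ X.A Y.A Z.A).inv ≫ quo X Y ▷ Z.A ≫ quo (modTensor X Y) Z) (by
    symm
    calc _ = 𝟙 _ ⊗≫ ((X.A ⊗ Y.A) ◁ lact Z ≫ quo X Y ▷ Z.A) ≫ quo (modTensor X Y) Z := by monoidal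
      _ = 𝟙 _ ⊗≫ quo X Y ▷ (ob M ⊗ Z.A) ⊗≫ ((α_ _ _ _).hom ≫
            (modTensor X Y).A ◁ lact Z ≫ quo (modTensor X Y) Z) := by
        rw [whisker_exchange]; monoidal
      _ = 𝟙 _ ⊗≫ (quo X Y ▷ ob M ≫ act (modTensor X Y)) ▷ Z.A ≫ quo (modTensor X Y) Z := by
        rw [← quo_condition]; monoidal
      _ = _ := by rw [quo_act]; monoidal)

theorem quo_assocInvAux (X Y Z : RMod M) : X.A ◁ quo Y Z ≫ assocInvAux X Y Z =
    (α_ X.A Y.A Z.A).inv ≫ quo X Y ▷ Z.A ≫ quo (modTensor X Y) Z := quo_descL _ _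

/-- The inverse of the associator. -/
def assocInv (X Y Z : RMod M) :
    modTensor X (modTensor Y Z) ⟶ modTensor (modTensor X Y) Z :=
  descHom (assocInvAux X Y Z)
    (by
      rw [← cancel_epi ((X.A ⊗ ob M) ◁ quo Y Z)]
      calc _ = ((X.A ⊗ ob M) ◁ quo Y Z ≫ act X ▷ (modTensor Y Z).A) ≫ assocInvAux X Y Z := by
            rw [Category.assoc]
        _ = act X ▷ (Y.A ⊗ Z.A) ≫ (X.A ◁ quo Y Z ≫ assocInvAux X Y Z) := by
          rw [whisker_exchange, Category.assoc]
        _ = 𝟙 _ ⊗≫ (act X ▷ Y.A ≫ quo X Y) ▷ Z.A ≫ quo (modTensor X Y) Z := by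
          rw [quo_assocInvAux]; monoidal
        _ = 𝟙 _ ⊗≫ X.A ◁ lact Y ▷ Z.A ≫
              ((α_ X.A Y.A Z.A).inv ≫ quo X Y ▷ Z.A ≫ quo (modTensor X Y) Z) := by
          rw [quo_condition]; monoidal
        _ = 𝟙 _ ⊗≫ X.A ◁ ((α_ _ _ _).inv ≫ lact Y ▷ Z.A ≫ quo Y Z) ≫ assocInvAux X Y Z := by
          rw [← quo_assocInvAux]; monoidal
        _ = _ := by rw [← quo_lact]; monoidal)
    (by
      rw [← cancel_epi ((X.A ◁ quo Y Z) ▷ ob M)]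
      calc _ = (X.A ◁ quo Y Z ≫ assocInvAux X Y Z) ▷ ob M ≫
              act (modTensor (modTensor X Y) Z) := by monoidal
        _ = ((α_ X.A Y.A Z.A).inv ≫ quo X Y ▷ Z.A) ▷ ob M ≫
              (quo (modTensor X Y) Z ▷ ob M ≫ act (modTensor (modTensor X Y) Z)) := by
          rw [quo_assocInvAux]; monoidal
        _ = 𝟙 _ ⊗≫ (quo X Y ▷ (Z.A ⊗ ob M) ≫ (modTensor X Y).A ◁ act Z) ≫
              quo (modTensor X Y) Z := by
          rw [quo_act]; monoidal
        _ = 𝟙 _ ⊗≫ X.A ◁ Y.A ◁ act Z ≫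
              ((α_ X.A Y.A Z.A).inv ≫ quo X Y ▷ Z.A ≫ quo (modTensor X Y) Z) := by
          rw [← whisker_exchange]; monoidal
        _ = 𝟙 _ ⊗≫ X.A ◁ ((α_ _ _ _).hom ≫ Y.A ◁ act Z ≫ quo Y Z) ≫ assocInvAux X Y Z := by
          rw [← quo_assocInvAux]; monoidal
        _ = _ := by rw [← quo_act]; monoidal)

theorem quo_assocInv (X Y Z : RMod M) :
    X.A ◁ quo Y Z ≫ quo X (modTensor Y Z) ≫ (assocInv X Y Z).f =
      (α_ X.A Y.A Z.A).inv ≫ quo X Y ▷ Z.A ≫ quo (modTensor X Y) Z := by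
  unfold assocInv
  rw [quo_descHom, quo_assocInvAux]

/-- The associator of `⊗_M`, induced by the one of `C`. -/
def assocIso (X Y Z : RMod M) :
    modTensor (modTensor X Y) Z ≅ modTensor X (modTensor Y Z) where
  hom := assocHom X Y Z
  inv := assocInv X Y Z
  hom_inv_id := by
    apply tensor_hom_ext
    rw [← cancel_epi (quo X Y ▷ Z.A), Monad.Algebra.comp_f, Monad.Algebra.id_f, Category.comp_id,
      reassoc_of% quo_assocHom X Y Z, quo_assocInv, Iso.hom_inv_id_assoc]
  inv_hom_id := by
    apply tensor_hom_ext
    rw [← cancel_epi (X.A ◁ quo Y Z), Monad.Algebra.comp_f, Monad.Algebra.id_f, Category.comp_id,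
      reassoc_of% quo_assocInv X Y Z, quo_assocHom, Iso.inv_hom_id_assoc]

/-- The left unitor `M ⊗_M X ≅ X`, induced by the left action. -/
def leftUnitorIso (X : RMod M) : modTensor (unitObj M) X ≅ X :=
  let q : ob M ⊗ X.A ⟶ (modTensor (unitObj M) X).A := quo (unitObj M) X
  let d : (modTensor (unitObj M) X).A ⟶ X.A := desc (X := unitObj M) (lact X) (lact_mul X)
  have hq : Epi q := inferInstanceAs (Epi (quo (unitObj M) X))
  have hd : q ≫ d = lact X := quo_desc _ _
  have hc : mul M ▷ X.A ≫ q = (α_ (ob M) (ob M) X.A).hom ≫ ob M ◁ lact X ≫ q :=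
    quo_condition (unitObj M) X
  have ha : q ▷ ob M ≫ act (modTensor (unitObj M) X) =
    (α_ (ob M) X.A (ob M)).hom ≫ ob M ◁ act X ≫ q := quo_act (unitObj M) X
  have hq' : Epi (q ▷ ob M) := inferInstanceAs (Epi (quo (unitObj M) X ▷ ob M))
  Monad.Algebra.isoMk
    { hom := d
      inv := (λ_ X.A).inv ≫ one M ▷ X.A ≫ q
      hom_inv_id := by
        rw [← cancel_epi q, reassoc_of% hd, Category.comp_id]
        calc _ = (λ_ _).inv ≫ (𝟙_ C ◁ lact X ≫ one M ▷ X.A) ≫ q := by monoidal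
          _ = (λ_ _).inv ≫ one M ▷ (ob M ⊗ X.A) ≫ (α_ _ _ _).inv ≫
                ((α_ _ _ _).hom ≫ ob M ◁ lact X ≫ q) := by rw [whisker_exchange]; monoidal
          _ = 𝟙 _ ⊗≫ (one M ▷ ob M ≫ mul M) ▷ X.A ≫ q := by rw [← hc]; monoidal
          _ = _ := by rw [mon_one_mul]; monoidal
      inv_hom_id := by
        rw [Category.assoc, Category.assoc, hd, lact_one, Iso.inv_hom_id] }
    (by
      change d ▷ ob M ≫ act X = act (modTensor (unitObj M) X) ≫ d
      rw [← cancel_epi (q ▷ ob M), ← comp_whiskerRight_assoc, hd, lact_act, reassoc_of% ha, hd])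

theorem quo_leftUnitor (X : RMod M) : quo (unitObj M) X ≫ (leftUnitorIso X).hom.f = lact X :=
  quo_desc (X := unitObj M) (lact X) (lact_mul X)

/-- The right unitor `X ⊗_M M ≅ X`, induced by the action. -/
def rightUnitorIso (X : RMod M) : modTensor X (unitObj M) ≅ X :=
  let q : X.A ⊗ ob M ⟶ (modTensor X (unitObj M)).A := quo X (unitObj M)
  let d : (modTensor X (unitObj M)).A ⟶ X.A :=
    desc (Y := unitObj M) (act X) (by rw [lact_unitObj]; exact act_mul X)
  have hq : Epi q := inferInstanceAs (Epi (quo X (unitObj M)))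
  have hd : q ≫ d = act X := quo_desc _ _
  have hc : act X ▷ ob M ≫ q = (α_ X.A (ob M) (ob M)).hom ≫ X.A ◁ mul M ≫ q := by
    have h := quo_condition X (unitObj M)
    rw [lact_unitObj] at h
    exact h
  have ha : q ▷ ob M ≫ act (modTensor X (unitObj M)) =
    (α_ X.A (ob M) (ob M)).hom ≫ X.A ◁ mul M ≫ q := quo_act X (unitObj M)
  have hq' : Epi (q ▷ ob M) := inferInstanceAs (Epi (quo X (unitObj M) ▷ ob M))
  Monad.Algebra.isoMk
    { hom := d
      inv := (ρ_ X.A).inv ≫ X.A ◁ one M ≫ q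
      hom_inv_id := by
        rw [← cancel_epi q, reassoc_of% hd, Category.comp_id]
        calc _ = (ρ_ _).inv ≫ (act X ▷ 𝟙_ C ≫ X.A ◁ one M) ≫ q := by monoidal
          _ = (ρ_ _).inv ≫ (X.A ⊗ ob M) ◁ one M ≫ act X ▷ ob M ≫ q := by
            rw [← whisker_exchange, Category.assoc]
          _ = 𝟙 _ ⊗≫ X.A ◁ (ob M ◁ one M ≫ mul M) ≫ q := by rw [hc]; monoidal
          _ = _ := by rw [mon_mul_one]; monoidal
      inv_hom_id := by
        rw [Category.assoc, Category.assoc, hd, act_one, Iso.inv_hom_id] }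
    (by
      change d ▷ ob M ≫ act X = act (modTensor X (unitObj M)) ≫ d
      rw [← cancel_epi (q ▷ ob M), ← comp_whiskerRight_assoc, hd, act_mul, reassoc_of% ha, hd])

theorem quo_rightUnitor (X : RMod M) : quo X (unitObj M) ≫ (rightUnitorIso X).hom.f = act X :=
  quo_desc (Y := unitObj M) (act X) (by rw [lact_unitObj]; exact act_mul X)

/-- `f ⊗_M g`. -/
def modTensorHom {X X' Y Y' : RMod M} (f : X ⟶ X') (g : Y ⟶ Y') : modTensor X Y ⟶ modTensor X' Y' :=
  whiskerR f Y ≫ whiskerL X' g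

theorem quo_tensorHom {X X' Y Y' : RMod M} (f : X ⟶ X') (g : Y ⟶ Y') :
    quo X Y ≫ (modTensorHom f g).f = (f.f ⊗ₘ g.f) ≫ quo X' Y' := by
  unfold modTensorHom
  rw [Monad.Algebra.comp_f, reassoc_of% quo_whiskerR f Y, quo_whiskerL, MonoidalCategory.tensorHom_def,
    Category.assoc]

theorem tensor₃_hom_ext {X Y Z W : RMod M} {f g : modTensor (modTensor X Y) Z ⟶ W}
    (h : quo X Y ▷ Z.A ≫ quo (modTensor X Y) Z ≫ f.f =
      quo X Y ▷ Z.A ≫ quo (modTensor X Y) Z ≫ g.f) : f = g :=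
  tensor_hom_ext ((cancel_epi (quo X Y ▷ Z.A)).1 h)

/-- The tensor product `⊗_M` makes the category of right `M`-modules a monoidal category. -/
instance : MonoidalCategory (RMod M) where
  tensorObj := modTensor
  tensorHom := modTensorHom
  whiskerLeft X _ _ f := whiskerL X f
  whiskerRight f Y := whiskerR f Y
  tensorUnit := unitObj M
  associator := assocIso
  leftUnitor := leftUnitorIso
  rightUnitor := rightUnitorIso
  tensorHom_def _ _ := rfl
  id_tensorHom_id X Y := by
    apply tensor_hom_ext
    rw [quo_tensorHom]; simp
  tensorHom_comp_tensorHom f₁ f₂ g₁ g₂ := by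
    apply tensor_hom_ext
    rw [Monad.Algebra.comp_f, reassoc_of% quo_tensorHom f₁ f₂, quo_tensorHom, quo_tensorHom]; simp
  whiskerLeft_id X Y := by
    apply tensor_hom_ext
    rw [quo_whiskerL]; simp
  id_whiskerRight X Y := by
    apply tensor_hom_ext
    rw [quo_whiskerR]; simp
  associator_naturality {X₁ X₂ X₃ Y₁ Y₂ Y₃} f₁ f₂ f₃ := by
    apply tensor₃_hom_ext
    change _ ≫ _ ≫ (modTensorHom (modTensorHom f₁ f₂) f₃).f ≫ (assocHom Y₁ Y₂ Y₃).f =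
      _ ≫ _ ≫ (assocHom X₁ X₂ X₃).f ≫ (modTensorHom f₁ (modTensorHom f₂ f₃)).f
    rw [reassoc_of% quo_assocHom X₁ X₂ X₃, reassoc_of% quo_tensorHom (modTensorHom f₁ f₂) f₃,
      quo_tensorHom, whiskerLeft_comp_tensorHom_assoc, whiskerRight_comp_tensorHom_assoc,
      quo_tensorHom, quo_tensorHom]
    calc _ = ((f₁.f ⊗ₘ f₂.f) ⊗ₘ f₃.f) ≫
          (quo Y₁ Y₂ ▷ Y₃.A ≫ quo (modTensor Y₁ Y₂) Y₃ ≫ (assocHom Y₁ Y₂ Y₃).f) := by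
            rw [tensorHom_comp_whiskerRight_assoc]
      _ = _ := by
        rw [quo_assocHom, associator_naturality_assoc, tensorHom_comp_whiskerLeft_assoc]
  leftUnitor_naturality {X Y} f := by
    apply tensor_hom_ext
    change _ ≫ (whiskerL (unitObj M) f).f ≫ (leftUnitorIso Y).hom.f =
      _ ≫ (leftUnitorIso X).hom.f ≫ f.f
    rw [reassoc_of% quo_whiskerL (unitObj M) f, quo_leftUnitor, reassoc_of% quo_leftUnitor X]
    exact hom_lact f
  rightUnitor_naturality {X Y} f := by
    apply tensor_hom_ext
    change _ ≫ (whiskerR f (unitObj M)).f ≫ (rightUnitorIso Y).hom.f =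
      _ ≫ (rightUnitorIso X).hom.f ≫ f.f
    rw [reassoc_of% quo_whiskerR f (unitObj M), quo_rightUnitor, reassoc_of% quo_rightUnitor X]
    exact hom_act f
  pentagon W X Y Z := by
    apply tensor₃_hom_ext
    rw [← cancel_epi (quo W X ▷ Y.A ▷ Z.A)]
    change _ ≫ _ ≫ _ ≫ (whiskerR (assocHom W X Y) Z).f ≫ (assocHom W (modTensor X Y) Z).f ≫
      (whiskerL W (assocHom X Y Z)).f =
      _ ≫ _ ≫ _ ≫ (assocHom (modTensor W X) Y Z).f ≫ (assocHom W X (modTensor Y Z)).f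
    calc _ = (quo W X ▷ Y.A ≫ quo (modTensor W X) Y ≫ (assocHom W X Y).f) ▷ Z.A ≫
          quo (modTensor W (modTensor X Y)) Z ≫ (assocHom W (modTensor X Y) Z).f ≫
            (whiskerL W (assocHom X Y Z)).f := by
          rw [reassoc_of% quo_whiskerR (assocHom W X Y) Z]; simp only [comp_whiskerRight, Category.assoc]
      _ = ((α_ _ _ _).hom ≫ W.A ◁ quo X Y) ▷ Z.A ≫
          (quo W (modTensor X Y) ▷ Z.A ≫ quo (modTensor W (modTensor X Y)) Z ≫
            (assocHom W (modTensor X Y) Z).f) ≫ (whiskerL W (assocHom X Y Z)).f := by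
          rw [quo_assocHom]; simp only [comp_whiskerRight, Category.assoc]
      _ = 𝟙 _ ⊗≫ W.A ◁ (quo X Y ▷ Z.A ≫ quo (modTensor X Y) Z ≫ (assocHom X Y Z).f) ≫
          quo W (modTensor X (modTensor Y Z)) := by
          rw [quo_assocHom, Category.assoc, Category.assoc, quo_whiskerL]; monoidal
      _ = (α_ _ _ _).hom ≫ (W.A ⊗ X.A) ◁ quo Y Z ≫ ((α_ _ _ _).hom ≫
          W.A ◁ quo X (modTensor Y Z) ≫ quo W (modTensor X (modTensor Y Z))) := by
          rw [quo_assocHom]; monoidal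
      _ = (α_ _ _ _).hom ≫ ((W.A ⊗ X.A) ◁ quo Y Z ≫ quo W X ▷ (modTensor Y Z).A) ≫
          quo (modTensor W X) (modTensor Y Z) ≫ (assocHom W X (modTensor Y Z)).f := by
          rw [← quo_assocHom, Category.assoc]
      _ = quo W X ▷ Y.A ▷ Z.A ≫ ((α_ _ _ _).hom ≫ (modTensor W X).A ◁ quo Y Z ≫
          quo (modTensor W X) (modTensor Y Z)) ≫ (assocHom W X (modTensor Y Z)).f := by
          rw [whisker_exchange]; monoidal
      _ = _ := by rw [← quo_assocHom]; simp only [Category.assoc]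
  triangle X Y := by
    apply tensor₃_hom_ext
    change _ ≫ _ ≫ (assocHom X (unitObj M) Y).f ≫ (whiskerL X (leftUnitorIso Y).hom).f =
      _ ≫ _ ≫ (whiskerR (rightUnitorIso X).hom Y).f
    rw [reassoc_of% quo_assocHom X (unitObj M) Y, quo_whiskerL, quo_whiskerR,
      ← whiskerLeft_comp_assoc, ← comp_whiskerRight_assoc, quo_leftUnitor, quo_rightUnitor]
    exact (quo_condition X Y).symm

end Tensor

section Adjunctions

variable {D : Type u₂} [Category.{v₂} D] [MonoidalCategory D] {G : C ⥤ D} {R : D ⥤ C}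

/-- A monoidal adjunction: both functors are lax monoidal, and the unit and the counit are
monoidal transformations. -/
structure IsMonoidalAdjunction (adj : G ⊣ R) [G.LaxMonoidal] [R.LaxMonoidal] : Prop where
  unit : NatTrans.IsMonoidal adj.unit
  counit : NatTrans.IsMonoidal adj.counit

/-- The left projection formula morphism `A ⊗ R X ⟶ R G A ⊗ R X ⟶ R (G A ⊗ X)`. -/
def lproj (adj : G ⊣ R) [R.LaxMonoidal] (A : C) (X : D) :
    A ⊗ R.obj X ⟶ R.obj (G.obj A ⊗ X) :=
  adj.unit.app A ▷ R.obj X ≫ Functor.LaxMonoidal.μ R (G.obj A) X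

/-- The right projection formula morphism `R X ⊗ A ⟶ R X ⊗ R G A ⟶ R (X ⊗ G A)`. -/
def rproj (adj : G ⊣ R) [R.LaxMonoidal] (X : D) (A : C) :
    R.obj X ⊗ A ⟶ R.obj (X ⊗ G.obj A) :=
  R.obj X ◁ adj.unit.app A ≫ Functor.LaxMonoidal.μ R X (G.obj A)

/-- The (left and right) projection formula holds for the right adjoint. -/
def ProjectionFormula (adj : G ⊣ R) [R.LaxMonoidal] : Prop :=
  (∀ (A : C) (X : D), IsIso (lproj adj A X)) ∧ ∀ (X : D) (A : C), IsIso (rproj adj X A)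

variable (M)

/-- The natural transformation `T_M ⟶ RG` underlying a morphism of monads. -/
def monadHomNat (adj : G ⊣ R) (φ : tensorMonad M ⟶ adj.toMonad) :
    (tensorMonad M).toFunctor ⟶ G ⋙ R := φ.toNatTrans

/-- The comparison functor `D ⥤ Mod_C(M)` for an adjunction `G ⊣ R` whose monad is identified
with `T_M` by `φ`: it sends `X` to `R X` with the action
`R X ⊗ M = T_M (R X) ⟶ R G R X ⟶ R X` given by `φ` and the counit, and is `R` on morphisms. -/
def comparison (adj : G ⊣ R) (φ : tensorMonad M ⟶ adj.toMonad) : D ⥤ RMod M :=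
  Monad.comparison adj ⋙ Monad.algebraFunctorOfMonadHom φ

/-- The natural transformation from the free module functor to `G` followed by the comparison
functor with components `φ_A : A ⊗ M ⟶ R G A`. -/
def freeToComparison (adj : G ⊣ R) (φ : tensorMonad M ⟶ adj.toMonad) :
    (tensorMonad M).free ⟶ G ⋙ comparison M adj φ where
  app A :=
    { f := φ.app A
      h := by
        have h := φ.app_μ A
        rw [Category.assoc] at h
        exact (Category.assoc _ _ _).symm.trans ((Category.assoc _ _ _).trans h.symm) }
  naturality A B f := by
    apply Monad.Algebra.Hom.ext'
    exact φ.naturality f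

end Adjunctions

end CentralMonoid

end

/-! ### Morphisms out of `M` and bilinear morphisms -/

noncomputable section

namespace CentralMonoid

open Functor.LaxMonoidal

variable {C : Type u₁} [Category.{v₁} C] [MonoidalCategory C] {M : Center C} [MonObj M]

/-! All diagrams of modules are tested on underlying morphisms of `C`. The quotient `quo X Y` is an
epimorphism and remains one after tensoring, so morphisms of modules out of `X ⊗_M Y` amount to
bilinear morphisms out of `X.A ⊗ Y.A` (balanced over `M` and linear in the last variable,
`IsBilinear`); since `M` is free on `𝟙_ C`, morphisms of modules out of `M` amount to morphisms out
of `𝟙_ C`. Hence a lax monoidal structure on the underlying functor of `K : D ⥤ RMod M` lifts to `K`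
as soon as its tensorators are bilinear (`liftLaxMonoidal`), and the lift is determined by its
underlying data. Both halves of bilinearity follow from one equation, compatibility with the lax
structure `laxT` of `T_M` (`IsBilinear.of_laxT`).

`Free` arises by lifting the lax structure of `T_M`. The projection formula comes from explicit
inverses: `(A ⊗ M) ⊗_M X ≅ A ⊗ X` by letting `M` act on `X` from the left, and `X ⊗_M (A ⊗ M) ≅ X ⊗
A` by moving `M` back past `A` with the inverse half-braiding and letting it act on `X`
(`freeTensor_isIso`, `tensorFree_isIso`). Strength of `Free` follows from the first of these.

For the universal property, `K.map` of the counit is a module morphism out of a free module which,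
by a triangle identity, is the identity on generators; this forces the action on `K.obj X`
(`eq_comparison_of_comp_forget_eq`). The tensorators of `R` are bilinear for the comparison actions
because `φ` and the counit are monoidal (`comparisonAct_tensorHom_μ`), so they lift. Strict
equalities of functors are treated as monoidality of `eqToHom`. -/

/-- A morphism of modules out of `M` is determined by its composition with the unit of `M`. -/
theorem unitObj_hom_ext {X : RMod M} {f g : unitObj M ⟶ X} (h : one M ≫ f.f = one M ≫ g.f) :
    f = g := by
  -- The module `M` is generated by its unit: multiply by the unit on the left, then use linearity
  -- of `k`.
  have key (k : ob M ⟶ X.A) (hk : k ▷ ob M ≫ act X = mul M ≫ k) :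
      k = (λ_ (ob M)).inv ≫ (one M ≫ k) ▷ ob M ≫ act X := by
    rw [comp_whiskerRight, Category.assoc, hk, ← Category.assoc (one M ▷ ob M), mon_one_mul,
      Iso.inv_hom_id_assoc]
  ext
  exact (key f.f (hom_act f)).trans
    ((congrArg (fun k => (λ_ (ob M)).inv ≫ k ▷ ob M ≫ act X) h).trans (key g.f (hom_act g)).symm)

/-- The morphism of modules `M ⟶ X` corresponding to a morphism `𝟙 ⟶ X` of `C`. -/
def unitDesc {X : RMod M} (e : 𝟙_ C ⟶ X.A) : unitObj M ⟶ X where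
  f := (λ_ (ob M)).inv ≫ e ▷ ob M ≫ act X
  h := by
    change ((λ_ (ob M)).inv ≫ e ▷ ob M ≫ act X) ▷ ob M ≫ act X =
      mul M ≫ (λ_ (ob M)).inv ≫ e ▷ ob M ≫ act X
    calc _ = 𝟙 _ ⊗≫ e ▷ ob M ▷ ob M ≫ (act X ▷ ob M ≫ act X) := by monoidal
      _ = 𝟙 _ ⊗≫ (e ▷ (ob M ⊗ ob M) ≫ X.A ◁ mul M) ≫ act X := by rw [act_mul]; monoidal
      _ = _ := by rw [← whisker_exchange]; monoidal

theorem one_unitDesc {X : RMod M} (e : 𝟙_ C ⟶ X.A) : one M ≫ (unitDesc e).f = e := by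
  change one M ≫ (λ_ (ob M)).inv ≫ e ▷ ob M ≫ act X = e
  calc _ = 𝟙 _ ⊗≫ (𝟙_ C ◁ one M ≫ e ▷ ob M) ≫ act X := by monoidal
    _ = 𝟙 _ ⊗≫ e ▷ 𝟙_ C ≫ (X.A ◁ one M ≫ act X) := by rw [whisker_exchange]; monoidal
    _ = _ := by rw [act_one]; monoidal

variable [HasReflexiveCoequalizers C]
  [∀ A : C, Monad.PreservesColimitOfIsReflexivePair (tensorRight A)]
  [∀ A : C, Monad.PreservesColimitOfIsReflexivePair (tensorLeft A)]
  [IsCommMonObj M]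

/-- This and the following equations for `quo` are phrased in the monoidal notation of `RMod M`, the
form in which they rewrite the coherence diagrams of lax monoidal functors. -/
theorem quo_whiskerLeft (X : RMod M) {Y Z : RMod M} (f : Y ⟶ Z) :
    quo X Y ≫ (X ◁ f).f = X.A ◁ f.f ≫ quo X Z := quo_whiskerL X f

theorem quo_whiskerRight {X Z : RMod M} (f : X ⟶ Z) (Y : RMod M) :
    quo X Y ≫ (f ▷ Y).f = f.f ▷ Y.A ≫ quo Z Y := quo_whiskerR f Y

theorem quo_tensorHom_f {X₁ X₂ Y₁ Y₂ : RMod M} (f : X₁ ⟶ Y₁) (g : X₂ ⟶ Y₂) :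
    quo X₁ X₂ ≫ (f ⊗ₘ g).f = (f.f ⊗ₘ g.f) ≫ quo Y₁ Y₂ := quo_tensorHom f g

theorem quo_associator (X Y Z : RMod M) :
    quo X Y ▷ Z.A ≫ quo (X ⊗ Y) Z ≫ (α_ X Y Z).hom.f =
      (α_ X.A Y.A Z.A).hom ≫ X.A ◁ quo Y Z ≫ quo X (Y ⊗ Z) := quo_assocHom X Y Z

theorem quo_leftUnitor_hom (X : RMod M) : quo (𝟙_ (RMod M)) X ≫ (λ_ X).hom.f = lact X :=
  quo_leftUnitor X

theorem quo_rightUnitor_hom (X : RMod M) : quo X (𝟙_ (RMod M)) ≫ (ρ_ X).hom.f = act X :=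
  quo_rightUnitor X

theorem tensorObj_hom_ext {X Y Z : RMod M} {f g : X ⊗ Y ⟶ Z}
    (h : quo X Y ≫ f.f = quo X Y ≫ g.f) : f = g := tensor_hom_ext h

/-- The forgetful functor from modules is lax monoidal, by the quotient morphisms. -/
abbrev forgetLaxMonoidal : (tensorMonad M).forget.LaxMonoidal where
  ε := one M
  μ X Y := quo X Y
  μ_natural_left f Y := (quo_whiskerRight f Y).symm
  μ_natural_right X f := (quo_whiskerLeft X f).symm
  associativity X Y Z := quo_associator X Y Z
  left_unitality X := (lact_one X).symm.trans
    (congrArg (one M ▷ X.A ≫ ·) (quo_leftUnitor_hom X).symm)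
  right_unitality X := (act_one X).symm.trans
    (congrArg (X.A ◁ one M ≫ ·) (quo_rightUnitor_hom X).symm)

/-- A morphism `X ⊗ Y ⟶ Z` is balanced and linear, i.e. factors through a morphism of modules
`X ⊗_M Y ⟶ Z`. -/
structure IsBilinear {X Y Z : RMod M} (m : X.A ⊗ Y.A ⟶ Z.A) : Prop where
  balanced : act X ▷ Y.A ≫ m = (α_ X.A (ob M) Y.A).hom ≫ X.A ◁ lact Y ≫ m
  linear : m ▷ ob M ≫ act Z = (α_ X.A Y.A (ob M)).hom ≫ X.A ◁ act Y ≫ m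

/-- Bilinearity in terms of both actions at once. -/
theorem IsBilinear.of_laxT {X Y Z : RMod M} {m : X.A ⊗ Y.A ⟶ Z.A}
    (h : (act X ⊗ₘ act Y) ≫ m = laxT M X.A Y.A ≫ m ▷ ob M ≫ act Z) : IsBilinear m := by
  have lin : m ▷ ob M ≫ act Z = (α_ X.A Y.A (ob M)).hom ≫ X.A ◁ act Y ≫ m := by
    -- Inserting the unit into the copy of `M` beside `X` removes `act X` and, by `one_swapMul`,
    -- also the half-braiding; linearity remains.
    have h' := congrArg (fun k => ((ρ_ X.A).inv ≫ X.A ◁ one M) ▷ (Y.A ⊗ ob M) ≫ k) h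
    rw [MonoidalCategory.tensorHom_def, Category.assoc, ← comp_whiskerRight_assoc,
      Category.assoc, act_one, Iso.inv_hom_id, id_whiskerRight, Category.id_comp] at h'
    rw [h', laxT]
    symm
    calc _ = 𝟙 _ ⊗≫ X.A ◁ (one M ▷ (Y.A ⊗ ob M) ≫ swapMul M Y.A) ⊗≫ m ▷ ob M ≫ act Z := by
          monoidal
      _ = _ := by rw [one_swapMul]; monoidal
  refine ⟨?_, lin⟩
  -- Inserting the unit beside `Y` instead removes `act Y`. By `lin` the action on `Z` becomes the
  -- action on `Y`, and together with the half-braiding this is `lact Y`.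
  have h' := congrArg (fun k => (X.A ⊗ ob M) ◁ ((ρ_ Y.A).inv ≫ Y.A ◁ one M) ≫ k) h
  rw [MonoidalCategory.tensorHom_def', Category.assoc, ← whiskerLeft_comp_assoc,
    Category.assoc, act_one, Iso.inv_hom_id, whiskerLeft_id, Category.id_comp, lin] at h'
  rw [h', laxT, swapMul]
  calc _ = 𝟙 _ ⊗≫ X.A ◁ (swap M Y.A ▷ 𝟙_ C ≫ (Y.A ⊗ ob M) ◁ one M) ⊗≫
        X.A ◁ Y.A ◁ mul M ⊗≫ X.A ◁ act Y ≫ m := by rw [← whisker_exchange]; monoidal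
    _ = 𝟙 _ ⊗≫ X.A ◁ swap M Y.A ⊗≫ X.A ◁ Y.A ◁ (ob M ◁ one M ≫ mul M) ⊗≫
        X.A ◁ act Y ≫ m := by monoidal
    _ = _ := by rw [mon_mul_one, lact]; monoidal

/-- The morphism of modules out of `X ⊗_M Y` induced by a bilinear morphism. -/
def IsBilinear.desc {X Y Z : RMod M} {m : X.A ⊗ Y.A ⟶ Z.A} (h : IsBilinear m) : X ⊗ Y ⟶ Z :=
  descHom m h.balanced h.linear

theorem IsBilinear.quo_desc {X Y Z : RMod M} {m : X.A ⊗ Y.A ⟶ Z.A} (h : IsBilinear m) :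
    quo X Y ≫ h.desc.f = m := quo_descHom m h.balanced h.linear

/-! ### Lifting lax monoidal structures to functors into modules -/

section Lift

variable {D : Type u₂} [Category.{v₂} D] [MonoidalCategory D] (K : D ⥤ RMod M)

section Underlying

variable (L : (K ⋙ (tensorMonad M).forget).LaxMonoidal)

/-- The unit of a lax monoidal structure on the underlying functor of a functor to modules. -/
def underlyingε : 𝟙_ C ⟶ (K.obj (𝟙_ D)).A := L.ε

/-- The tensorators of a lax monoidal structure on the underlying functor of a functor to
modules. -/
def underlyingμ (X Y : D) : (K.obj X).A ⊗ (K.obj Y).A ⟶ (K.obj (X ⊗ Y)).A := L.μ X Y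

theorem underlyingμ_associativity (X Y Z : D) :
    underlyingμ K L X Y ▷ (K.obj Z).A ≫ underlyingμ K L (X ⊗ Y) Z ≫ (K.map (α_ X Y Z).hom).f =
      (α_ _ _ _).hom ≫ (K.obj X).A ◁ underlyingμ K L Y Z ≫ underlyingμ K L X (Y ⊗ Z) :=
  L.associativity X Y Z

theorem underlying_left_unitality (X : D) : underlyingε K L ▷ (K.obj X).A ≫
    underlyingμ K L (𝟙_ D) X ≫ (K.map (λ_ X).hom).f = (λ_ (K.obj X).A).hom :=
  (L.left_unitality X).symm

theorem underlying_right_unitality (X : D) : (K.obj X).A ◁ underlyingε K L ≫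
    underlyingμ K L X (𝟙_ D) ≫ (K.map (ρ_ X).hom).f = (ρ_ (K.obj X).A).hom :=
  (L.right_unitality X).symm

end Underlying

/-- A lax monoidal structure on the underlying functor of a functor to modules lifts, if the
tensorators are bilinear. -/
abbrev liftLaxMonoidal (L : (K ⋙ (tensorMonad M).forget).LaxMonoidal)
    (h : ∀ X Y : D, IsBilinear (underlyingμ K L X Y)) : K.LaxMonoidal where
  ε := unitDesc (underlyingε K L)
  μ X Y := (h X Y).desc
  μ_natural_left {X Y} f Z := by
    apply tensorObj_hom_ext
    change _ ≫ (K.map f ▷ K.obj Z).f ≫ (h Y Z).desc.f = _ ≫ (h X Z).desc.f ≫ (K.map (f ▷ Z)).f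
    rw [reassoc_of% quo_whiskerRight, (h Y Z).quo_desc, reassoc_of% (h X Z).quo_desc]
    exact L.μ_natural_left f Z
  μ_natural_right {X Y} Z f := by
    apply tensorObj_hom_ext
    change _ ≫ (K.obj Z ◁ K.map f).f ≫ (h Z Y).desc.f = _ ≫ (h Z X).desc.f ≫ (K.map (Z ◁ f)).f
    rw [reassoc_of% quo_whiskerLeft, (h Z Y).quo_desc, reassoc_of% (h Z X).quo_desc]
    exact L.μ_natural_right Z f
  associativity X Y Z := by
    -- After precomposition with both quotient morphisms only the associativity of `L` in `C` is
    -- left.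
    apply tensor₃_hom_ext
    change quo _ _ ▷ (K.obj Z).A ≫ quo (K.obj X ⊗ K.obj Y) (K.obj Z) ≫
        ((h X Y).desc ▷ K.obj Z).f ≫ (h (X ⊗ Y) Z).desc.f ≫ (K.map (α_ X Y Z).hom).f =
      quo _ _ ▷ (K.obj Z).A ≫ quo (K.obj X ⊗ K.obj Y) (K.obj Z) ≫
        (α_ (K.obj X) (K.obj Y) (K.obj Z)).hom.f ≫ (K.obj X ◁ (h Y Z).desc).f ≫
          (h X (Y ⊗ Z)).desc.f
    rw [reassoc_of% quo_associator, reassoc_of% quo_whiskerRight, reassoc_of% quo_whiskerLeft,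
      (h X (Y ⊗ Z)).quo_desc, reassoc_of% (h (X ⊗ Y) Z).quo_desc, ← comp_whiskerRight_assoc,
      ← whiskerLeft_comp_assoc, (h X Y).quo_desc, (h Y Z).quo_desc]
    exact underlyingμ_associativity K L X Y Z
  left_unitality X := by
    apply tensorObj_hom_ext
    change _ = _ ≫ (unitDesc (underlyingε K L) ▷ K.obj X).f ≫ (h (𝟙_ D) X).desc.f ≫
      (K.map (λ_ X).hom).f
    rw [quo_leftUnitor_hom, reassoc_of% quo_whiskerRight, reassoc_of% (h (𝟙_ D) X).quo_desc]
    change _ = ((λ_ (ob M)).inv ≫ underlyingε K L ▷ ob M ≫ act (K.obj (𝟙_ D))) ▷ (K.obj X).A ≫ _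
    symm
    -- Balancedness moves `M` from `K.obj (𝟙_ D)` to `K.obj X`, where it acts by `lact`; this action
    -- slides past the unit, so that left unitality of `L` applies.
    calc _ = 𝟙 _ ⊗≫ underlyingε K L ▷ ob M ▷ (K.obj X).A ≫
          (act (K.obj (𝟙_ D)) ▷ (K.obj X).A ≫ underlyingμ K L (𝟙_ D) X) ≫
            (K.map (λ_ X).hom).f := by monoidal
      _ = 𝟙 _ ⊗≫ (underlyingε K L ▷ (ob M ⊗ (K.obj X).A) ≫ (K.obj (𝟙_ D)).A ◁ lact (K.obj X)) ≫
          underlyingμ K L (𝟙_ D) X ≫ (K.map (λ_ X).hom).f := by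
        rw [(h (𝟙_ D) X).balanced]; monoidal
      _ = 𝟙 _ ⊗≫ 𝟙_ C ◁ lact (K.obj X) ≫ (underlyingε K L ▷ (K.obj X).A ≫
          underlyingμ K L (𝟙_ D) X ≫ (K.map (λ_ X).hom).f) := by
        rw [← whisker_exchange]; monoidal
      _ = _ := by rw [underlying_left_unitality]; monoidal
  right_unitality X := by
    apply tensorObj_hom_ext
    change _ = _ ≫ (K.obj X ◁ unitDesc (underlyingε K L)).f ≫ (h X (𝟙_ D)).desc.f ≫
      (K.map (ρ_ X).hom).f
    rw [quo_rightUnitor_hom, reassoc_of% quo_whiskerLeft, reassoc_of% (h X (𝟙_ D)).quo_desc]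
    change _ = (K.obj X).A ◁ ((λ_ (ob M)).inv ≫ underlyingε K L ▷ ob M ≫ act (K.obj (𝟙_ D))) ≫ _
    symm
    -- Here linearity is used: the action on `K.obj (𝟙_ D)` becomes the one on `K.obj (X ⊗ 𝟙_ D)`,
    -- and then the one on `K.obj X` because `K.map (ρ_ X).hom` is a module morphism.
    calc _ = 𝟙 _ ⊗≫ ((K.obj X).A ◁ underlyingε K L) ▷ ob M ≫
          ((α_ _ _ _).hom ≫ (K.obj X).A ◁ act (K.obj (𝟙_ D)) ≫ underlyingμ K L X (𝟙_ D)) ≫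
            (K.map (ρ_ X).hom).f := by monoidal
      _ = 𝟙 _ ⊗≫ ((K.obj X).A ◁ underlyingε K L ≫ underlyingμ K L X (𝟙_ D)) ▷ ob M ≫
          (act (K.obj (X ⊗ 𝟙_ D)) ≫ (K.map (ρ_ X).hom).f) := by
        rw [← (h X (𝟙_ D)).linear]; monoidal
      _ = 𝟙 _ ⊗≫ ((K.obj X).A ◁ underlyingε K L ≫ underlyingμ K L X (𝟙_ D) ≫
          (K.map (ρ_ X).hom).f) ▷ ob M ≫ act (K.obj X) := by
        rw [← hom_act]; monoidal
      _ = _ := by rw [underlying_right_unitality]; monoidal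

theorem quo_liftLaxMonoidal_μ (L : (K ⋙ (tensorMonad M).forget).LaxMonoidal)
    (h : ∀ X Y : D, IsBilinear (underlyingμ K L X Y)) (X Y : D) :
    quo (K.obj X) (K.obj Y) ≫ ((liftLaxMonoidal K L h).μ X Y).f = underlyingμ K L X Y :=
  (h X Y).quo_desc

theorem one_liftLaxMonoidal_ε (L : (K ⋙ (tensorMonad M).forget).LaxMonoidal)
    (h : ∀ X Y : D, IsBilinear (underlyingμ K L X Y)) :
    one M ≫ (liftLaxMonoidal K L h).ε.f = underlyingε K L :=
  one_unitDesc _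

end Lift

end CentralMonoid

end

noncomputable section

namespace CentralMonoid

open Functor.LaxMonoidal

variable {C : Type u₁} [Category.{v₁} C] [MonoidalCategory C] {M : Center C} [MonObj M]

/-! ### Free modules and the half-braiding -/

/-- The unit `A ⟶ A ⊗ M` of the monad `T_M`. -/
def freeUnit (M : Center C) [MonObj M] (A : C) : A ⟶ A ⊗ ob M := (ρ_ A).inv ≫ A ◁ one M

theorem adj_unit_app (A : C) : (tensorMonad M).adj.unit.app A = freeUnit M A := by
  rw [Monad.adj_unit]; rfl

theorem adj_counit_app_f (X : RMod M) : ((tensorMonad M).adj.counit.app X).f = act X := by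
  rw [Monad.adj_counit]; simp; rfl

/-- The free module on `A`. -/
abbrev freeMod (M : Center C) [MonObj M] (A : C) : RMod M := (tensorMonad M).free.obj A

theorem freeUnit_act (A : C) :
    freeUnit M A ▷ ob M ≫ (α_ A (ob M) (ob M)).hom ≫ A ◁ mul M = 𝟙 _ :=
  (tensorMonad M).right_unit A

/-- The inverse `A ⊗ M ⟶ M ⊗ A` of the half-braiding. -/
def swapInv (M : Center C) (A : C) : A ⊗ ob M ⟶ ob M ⊗ A := (M.2.β A).inv

theorem swap_swapInv (M : Center C) (A : C) : swap M A ≫ swapInv M A = 𝟙 _ :=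
  (M.2.β A).hom_inv_id

theorem freeUnit_swapInv (A : C) : freeUnit M A ≫ swapInv M A = (λ_ A).inv ≫ one M ▷ A := by
  have h : (λ_ A).inv ≫ one M ▷ A ≫ swap M A = freeUnit M A := by
    rw [one_swap, Iso.inv_hom_id_assoc, freeUnit]
  rw [← h, Category.assoc, Category.assoc, swap_swapInv, Category.comp_id]

theorem freeUnit_swapMul [IsCommMonObj M] (A : C) :
    ob M ◁ freeUnit M A ≫ swapMul M A = swap M A := by
  unfold freeUnit swapMul
  calc _ = 𝟙 _ ⊗≫ ((ob M ⊗ A) ◁ one M ≫ swap M A ▷ ob M) ⊗≫ A ◁ mul M := by monoidal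
    _ = 𝟙 _ ⊗≫ swap M A ⊗≫ A ◁ (ob M ◁ one M ≫ mul M) := by rw [whisker_exchange]; monoidal
    _ = _ := by rw [mon_mul_one]; monoidal

/-- Compatibility of the half-braiding with `mul`, read through the isomorphism `M ⊗ A ≅ A ⊗ M`: the
left action `swapMul` on `A ⊗ M` corresponds to left multiplication on `M ⊗ A`. -/
theorem swap_swapMul [IsCommMonObj M] (A : C) :
    ob M ◁ swap M A ≫ swapMul M A ≫ swapInv M A = (α_ (ob M) (ob M) A).inv ≫ mul M ▷ A := by
  have h := congrArg (fun k => (α_ (ob M) (ob M) A).inv ≫ k ≫ swapInv M A) (mul_swap M A)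
  rw [Category.assoc, swap_swapInv, Category.comp_id] at h
  rw [h, swapMul]
  simp

theorem freeUnit_laxT [IsCommMonObj M] (A B : C) :
    freeUnit M A ▷ (B ⊗ ob M) ≫ laxT M A B = (α_ A B (ob M)).inv := by
  unfold freeUnit laxT
  calc _ = 𝟙 _ ⊗≫ A ◁ (one M ▷ (B ⊗ ob M) ≫ swapMul M B) ⊗≫ 𝟙 _ := by monoidal
    _ = _ := by rw [one_swapMul]; monoidal

variable [HasReflexiveCoequalizers C]
  [∀ A : C, Monad.PreservesColimitOfIsReflexivePair (tensorRight A)]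
  [∀ A : C, Monad.PreservesColimitOfIsReflexivePair (tensorLeft A)]
  [IsCommMonObj M]

/-! ### The projection formula -/

section ProjectionFormula

/-- The morphism `A ⊗ X ⟶ Free A ⊗_M X`. -/
def freeTensor (A : C) (X : RMod M) : A ⊗ X.A ⟶ (modTensor (freeMod M A) X).A :=
  freeUnit M A ▷ X.A ≫ quo (freeMod M A) X

/-- The morphism `X ⊗ A ⟶ X ⊗_M Free A`. -/
def tensorFree (X : RMod M) (A : C) : X.A ⊗ A ⟶ (modTensor X (freeMod M A)).A :=
  X.A ◁ freeUnit M A ≫ quo X (freeMod M A)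

/-- The inverse is induced by `A ◁ lact X`, which is balanced because the left action is associative
(`lact_mul`). One composite is unitality of `lact`; in the other, the coequalizer condition
transfers `M` from `X` to `A ⊗ M`, where the unit law of the monad applies. -/
theorem freeTensor_isIso (A : C) (X : RMod M) : IsIso (freeTensor A X) := by
  let q : (A ⊗ ob M) ⊗ X.A ⟶ (modTensor (freeMod M A) X).A := quo (freeMod M A) X
  have hq : Epi q := inferInstanceAs (Epi (quo (freeMod M A) X))
  have hc : ((α_ A (ob M) (ob M)).hom ≫ A ◁ mul M) ▷ X.A ≫ q =
    (α_ (A ⊗ ob M) (ob M) X.A).hom ≫ (A ⊗ ob M) ◁ lact X ≫ q := quo_condition (freeMod M A) X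
  have hb : ((α_ A (ob M) (ob M)).hom ≫ A ◁ mul M) ▷ X.A ≫ (α_ A (ob M) X.A).hom ≫ A ◁ lact X =
      (α_ (A ⊗ ob M) (ob M) X.A).hom ≫ (A ⊗ ob M) ◁ lact X ≫ (α_ A (ob M) X.A).hom ≫
        A ◁ lact X := by
    calc _ = 𝟙 _ ⊗≫ A ◁ (mul M ▷ X.A ≫ lact X) := by monoidal
      _ = _ := by rw [lact_mul]; monoidal
  let d : (modTensor (freeMod M A) X).A ⟶ A ⊗ X.A :=
    desc (X := freeMod M A) ((α_ A (ob M) X.A).hom ≫ A ◁ lact X) hb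
  have hd : q ≫ d = (α_ A (ob M) X.A).hom ≫ A ◁ lact X := quo_desc _ hb
  change IsIso (freeUnit M A ▷ X.A ≫ q)
  refine ⟨d, ?_, ?_⟩
  · rw [Category.assoc, hd, freeUnit]
    calc _ = 𝟙 _ ⊗≫ A ◁ (one M ▷ X.A ≫ lact X) := by monoidal
      _ = _ := by rw [lact_one]; monoidal
  · rw [← cancel_epi q, reassoc_of% hd]
    calc _ = (α_ A (ob M) X.A).hom ≫ (A ◁ lact X ≫ freeUnit M A ▷ X.A) ≫ q := by
          simp only [Category.assoc]
      _ = freeUnit M A ▷ ob M ▷ X.A ≫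
          ((α_ (A ⊗ ob M) (ob M) X.A).hom ≫ (A ⊗ ob M) ◁ lact X ≫ q) := by
        rw [whisker_exchange]; monoidal
      _ = (freeUnit M A ▷ ob M ≫ (α_ A (ob M) (ob M)).hom ≫ A ◁ mul M) ▷ X.A ≫ q := by
        rw [← hc]; monoidal
      _ = _ := by rw [freeUnit_act]; simp

/-- The inverse is induced by `e`, which carries `M` back past `A` and lets it act on `X`. Equations
out of `A ⊗ M` are checked after precomposition with the half-braiding, an isomorphism, which
cancels the `swapInv` in `e`. -/
theorem tensorFree_isIso (X : RMod M) (A : C) : IsIso (tensorFree X A) := by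
  let q : X.A ⊗ (A ⊗ ob M) ⟶ (modTensor X (freeMod M A)).A := quo X (freeMod M A)
  have hq : Epi q := inferInstanceAs (Epi (quo X (freeMod M A)))
  have hc : act X ▷ (A ⊗ ob M) ≫ q =
      (α_ X.A (ob M) (A ⊗ ob M)).hom ≫ X.A ◁ swapMul M A ≫ q := by
    rw [← lact_free]; exact quo_condition X (freeMod M A)
  have hs (W : C) : Epi (W ◁ swap M A) :=
    inferInstanceAs (Epi (W ◁ (M.2.β A).hom))
  let e : X.A ⊗ (A ⊗ ob M) ⟶ X.A ⊗ A :=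
    X.A ◁ swapInv M A ≫ (α_ X.A (ob M) A).inv ≫ act X ▷ A
  have he : X.A ◁ swap M A ≫ e = (α_ X.A (ob M) A).inv ≫ act X ▷ A := by
    rw [← whiskerLeft_comp_assoc, swap_swapInv, whiskerLeft_id, Category.id_comp]
  have hb : act X ▷ (A ⊗ ob M) ≫ e =
      (α_ X.A (ob M) (A ⊗ ob M)).hom ≫ X.A ◁ swapMul M A ≫ e := by
    -- On `X ⊗ M ⊗ M ⊗ A` balancedness becomes associativity of the right action on `X`, by
    -- `swap_swapMul`.
    rw [← cancel_epi ((X.A ⊗ ob M) ◁ swap M A), whisker_exchange_assoc, he]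
    calc _ = 𝟙 _ ⊗≫ (act X ▷ ob M ≫ act X) ▷ A := by monoidal
      _ = 𝟙 _ ⊗≫ X.A ◁ ((α_ (ob M) (ob M) A).inv ≫ mul M ▷ A) ⊗≫ act X ▷ A := by
        rw [act_mul]; monoidal
      _ = _ := by rw [← swap_swapMul]; monoidal
  have hb' : act X ▷ (A ⊗ ob M) ≫ e = (α_ X.A (ob M) (A ⊗ ob M)).hom ≫
      X.A ◁ lact (freeMod M A) ≫ e := by rw [lact_free]; exact hb
  let d : (modTensor X (freeMod M A)).A ⟶ X.A ⊗ A := desc (Y := freeMod M A) e hb'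
  have hd : q ≫ d = e := quo_desc _ hb'
  change IsIso (X.A ◁ freeUnit M A ≫ q)
  refine ⟨d, ?_, ?_⟩
  · rw [Category.assoc, hd, ← whiskerLeft_comp_assoc, freeUnit_swapInv]
    calc _ = 𝟙 _ ⊗≫ (X.A ◁ one M ≫ act X) ▷ A := by monoidal
      _ = _ := by rw [act_one]; monoidal
  · rw [← cancel_epi q, reassoc_of% hd, ← cancel_epi (X.A ◁ swap M A), reassoc_of% he]
    calc _ = (α_ X.A (ob M) A).inv ≫ (X.A ⊗ ob M) ◁ freeUnit M A ≫
          (act X ▷ (A ⊗ ob M) ≫ q) := by rw [whisker_exchange_assoc]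
      _ = X.A ◁ (ob M ◁ freeUnit M A ≫ swapMul M A) ≫ q := by rw [hc]; monoidal
      _ = _ := by rw [freeUnit_swapMul, Category.comp_id]

theorem projectionFormula_adj :
    @ProjectionFormula C _ _ _ _ _ _ _ (tensorMonad M).adj forgetLaxMonoidal := by
  refine ⟨fun A X => ?_, fun X A => ?_⟩
  · have := freeTensor_isIso A X
    rw [lproj, adj_unit_app]
    exact this
  · have := tensorFree_isIso X A
    rw [rproj, adj_unit_app]
    exact this

end ProjectionFormula

/-! ### `Free` is strong monoidal and the adjunction is monoidal -/

section Free

/-- The underlying functor of `Free` is `T_M`, hence lax monoidal. -/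
abbrev freeForgetLaxMonoidal : ((tensorMonad M).free ⋙ (tensorMonad M).forget).LaxMonoidal :=
  inferInstanceAs (tensorMonad M).toFunctor.LaxMonoidal

/-- Balancedness is associativity of the left action `swapMul` on a free module; linearity says that
this left action commutes with the right one, which rests on commutativity of `M`. -/
theorem isBilinear_laxT (A B : C) : IsBilinear (X := freeMod M A) (Y := freeMod M B)
    (Z := freeMod M (A ⊗ B)) (laxT M A B) := by
  constructor
  · rw [lact_free]
    change ((α_ A (ob M) (ob M)).hom ≫ A ◁ mul M) ▷ (B ⊗ ob M) ≫ laxT M A B =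
      (α_ (A ⊗ ob M) (ob M) (B ⊗ ob M)).hom ≫ (A ⊗ ob M) ◁ swapMul M B ≫ laxT M A B
    unfold laxT
    calc _ = 𝟙 _ ⊗≫ A ◁ (mul M ▷ (B ⊗ ob M) ≫ swapMul M B) ⊗≫ 𝟙 _ := by monoidal
      _ = _ := by rw [mul_swapMul]; monoidal
  · have h := lact_act (freeMod M B)
    rw [lact_free] at h
    replace h : swapMul M B ▷ ob M ≫ (α_ B (ob M) (ob M)).hom ≫ B ◁ mul M =
      (α_ (ob M) (B ⊗ ob M) (ob M)).hom ≫ ob M ◁ ((α_ B (ob M) (ob M)).hom ≫ B ◁ mul M) ≫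
        swapMul M B := h
    change laxT M A B ▷ ob M ≫ (α_ (A ⊗ B) (ob M) (ob M)).hom ≫ (A ⊗ B) ◁ mul M =
      (α_ (A ⊗ ob M) (B ⊗ ob M) (ob M)).hom ≫
        (A ⊗ ob M) ◁ ((α_ B (ob M) (ob M)).hom ≫ B ◁ mul M) ≫ laxT M A B
    unfold laxT
    calc _ = 𝟙 _ ⊗≫ A ◁ (swapMul M B ▷ ob M ≫ (α_ B (ob M) (ob M)).hom ≫ B ◁ mul M) ⊗≫ 𝟙 _ := by
          monoidal
      _ = _ := by rw [h]; monoidal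

/-- The free module functor is lax monoidal, by the factorization of the lax monoidal structure
of `T_M`. -/
abbrev freeLaxMonoidal : (tensorMonad M).free.LaxMonoidal :=
  liftLaxMonoidal (tensorMonad M).free freeForgetLaxMonoidal isBilinear_laxT

theorem quo_freeLaxMonoidal_μ (A B : C) :
    quo (freeMod M A) (freeMod M B) ≫ (freeLaxMonoidal.μ A B).f = laxT M A B :=
  quo_liftLaxMonoidal_μ _ _ isBilinear_laxT A B

theorem freeLaxMonoidal_ε : (freeLaxMonoidal (M := M)).ε.f = (λ_ (ob M)).inv := by
  change (λ_ (ob M)).inv ≫ (one M ≫ (λ_ (ob M)).inv) ▷ ob M ≫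
    (α_ (𝟙_ C) (ob M) (ob M)).hom ≫ 𝟙_ C ◁ mul M = _
  calc _ = 𝟙 _ ⊗≫ (one M ▷ ob M ≫ mul M) ⊗≫ 𝟙 _ := by monoidal
    _ = _ := by rw [mon_one_mul]; monoidal

theorem freeLaxMonoidal_ε_isIso : IsIso (freeLaxMonoidal (M := M)).ε := by
  have : IsIso (freeLaxMonoidal (M := M)).ε.f := by
    rw [freeLaxMonoidal_ε]; exact inferInstanceAs (IsIso (λ_ (ob M)).inv)
  exact Monad.algebra_iso_of_iso _ _

/-- Precomposed with the projection formula isomorphism `freeTensor A (freeMod M B)`, the tensorator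
becomes an inverse associator of `C`, so it is invertible by two-out-of-three. -/
theorem freeLaxMonoidal_μ_isIso (A B : C) : IsIso ((freeLaxMonoidal (M := M)).μ A B) := by
  have h : freeTensor A (freeMod M B) ≫ (freeLaxMonoidal.μ A B).f = (α_ A B (ob M)).inv := by
    refine Eq.trans (Category.assoc _ _ _) ?_
    exact (congrArg (freeUnit M A ▷ (B ⊗ ob M) ≫ ·) (quo_freeLaxMonoidal_μ A B)).trans
      (freeUnit_laxT A B)
  have := freeTensor_isIso A (freeMod M B)
  have : IsIso (freeTensor A (freeMod M B) ≫ (freeLaxMonoidal.μ A B).f) := by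
    rw [h]; exact inferInstanceAs (IsIso (α_ A B (ob M)).inv)
  have : IsIso (freeLaxMonoidal.μ A B).f := IsIso.of_isIso_comp_left (freeTensor A (freeMod M B)) _
  exact Monad.algebra_iso_of_iso _ _

/-- Both sides let the two copies of `M` act on `X`, one from each side; they agree since the two
actions commute. -/
theorem swapMul_act (X : RMod M) : swapMul M X.A ≫ act X = ob M ◁ act X ≫ lact X := by
  calc _ = (α_ _ _ _).inv ≫ swap M X.A ▷ ob M ≫
        ((α_ X.A (ob M) (ob M)).hom ≫ X.A ◁ mul M ≫ act X) := by
        simp only [swapMul, Category.assoc]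
    _ = (α_ _ _ _).inv ≫ (lact X ▷ ob M ≫ act X) := by
      rw [← act_mul, lact, comp_whiskerRight, Category.assoc]
    _ = _ := by rw [lact_act, Iso.inv_hom_id_assoc]

/-- The equation of `IsBilinear.of_laxT` for the universal bilinear morphism `quo`. It is the
compatibility of the counit, whose components are the actions, with tensor products. -/
theorem laxT_quo (X Y : RMod M) :
    laxT M X.A Y.A ≫ quo X Y ▷ ob M ≫ act (modTensor X Y) = (act X ⊗ₘ act Y) ≫ quo X Y := by
  rw [quo_act, laxT, MonoidalCategory.tensorHom_def', Category.assoc _ _ (quo X Y),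
    quo_condition]
  calc _ = 𝟙 _ ⊗≫ X.A ◁ (swapMul M Y.A ≫ act Y) ≫ quo X Y := by monoidal
    _ = _ := by rw [swapMul_act]; monoidal

theorem freeUnit_tensor (A B : C) :
    (freeUnit M A ⊗ₘ freeUnit M B) ≫ laxT M A B = freeUnit M (A ⊗ B) := by
  rw [MonoidalCategory.tensorHom_def', Category.assoc, freeUnit_laxT, freeUnit, freeUnit]
  monoidal

theorem isMonoidalAdjunction_adj : @IsMonoidalAdjunction C _ _ _ _ _ _ _ (tensorMonad M).adj
    freeLaxMonoidal forgetLaxMonoidal := by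
  let := freeLaxMonoidal (M := M)
  let := forgetLaxMonoidal (M := M)
  refine ⟨⟨?_, fun A B => ?_⟩, ⟨?_, fun X Y => ?_⟩⟩
  · rw [adj_unit_app]
    change 𝟙 _ ≫ freeUnit M (𝟙_ C) = one M ≫ (freeLaxMonoidal (M := M)).ε.f
    rw [freeLaxMonoidal_ε, freeUnit]
    change 𝟙 _ ≫ (ρ_ (𝟙_ C)).inv ≫ 𝟙_ C ◁ one M = one M ≫ (λ_ (ob M)).inv
    monoidal
  · rw [adj_unit_app, adj_unit_app, adj_unit_app]
    refine (Category.id_comp _).trans ((freeUnit_tensor A B).symm.trans ?_)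
    exact congrArg ((freeUnit M A ⊗ₘ freeUnit M B) ≫ ·) (quo_freeLaxMonoidal_μ A B).symm
  · ext
    refine (congrArg₂ (fun e c => (e ≫ one M ▷ ob M) ≫ c) freeLaxMonoidal_ε
      (adj_counit_app_f (unitObj M))).trans ?_
    change ((λ_ (ob M)).inv ≫ one M ▷ ob M) ≫ mul M = 𝟙 _
    rw [Category.assoc, mon_one_mul, Iso.inv_hom_id]
  · apply tensorObj_hom_ext
    have hμ : quo (freeMod M X.A) (freeMod M Y.A) ≫ ((freeLaxMonoidal.μ X.A Y.A ≫
        (tensorMonad M).free.map (quo X Y)) ≫ (tensorMonad M).adj.counit.app (X ⊗ Y)).f =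
        laxT M X.A Y.A ≫ quo X Y ▷ ob M ≫ act (modTensor X Y) := by
      rw [← quo_freeLaxMonoidal_μ, ← adj_counit_app_f]
      exact (congrArg _ (Category.assoc _ _ _)).trans (Category.assoc _ _ _).symm
    refine hμ.trans ((laxT_quo X Y).trans ?_)
    rw [← adj_counit_app_f, ← adj_counit_app_f]
    exact ((congrArg _ (Category.comp_id _)).trans (quo_tensorHom_f _ _)).symm

end Free

end CentralMonoid

end

noncomputable section

namespace CentralMonoid

/-! ### Strict equalities of modules, functors and lax monoidal functors -/

section EqToHom

variable {C : Type u₁} [Category.{v₁} C] {D : Type u₂} [Category.{v₂} D]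

theorem eqToHom_toNatTrans {T₁ T₂ : Monad C} (h : T₁ = T₂) :
    (eqToHom h : T₁ ⟶ T₂).toNatTrans = eqToHom (congrArg Monad.toFunctor h) := by
  subst h; rfl

theorem eqToHom_monad_app {T₁ T₂ : Monad C} (h : T₁ = T₂) (A : C) :
    (eqToHom h : T₁ ⟶ T₂).app A = eqToHom (congrArg (fun T : Monad C => T.obj A) h) := by
  subst h; rfl

theorem eqToHom_algebra_f {T : Monad C} {X Y : T.Algebra} (h : X = Y) :
    (eqToHom h).f = eqToHom (congrArg Monad.Algebra.A h) := by
  subst h; rfl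

/-- Once the carriers are identified, linearity of the identity says that the two actions coincide.
-/
theorem exists_eqToHom_of_f_eq_eqToHom {T : Monad C} {X Y : T.Algebra} (f : X ⟶ Y)
    (e : X.A = Y.A) (h : f.f = eqToHom e) : ∃ e' : X = Y, f = eqToHom e' := by
  obtain ⟨A, a, _, _⟩ := X
  obtain ⟨B, b, _, _⟩ := Y
  obtain ⟨k, hk⟩ := f
  dsimp only at e h hk
  subst e
  rw [eqToHom_refl] at h
  subst h
  obtain rfl : a = b := by simpa using hk.symm
  exact ⟨rfl, rfl⟩

/-- Naturality supplies the agreement on morphisms, so strict equality of functors can be proved by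
exhibiting a transformation. -/
theorem exists_eqToHom_of_app_eq_eqToHom {F F' : C ⥤ D} (τ : F ⟶ F')
    (h : ∀ X, ∃ e : F.obj X = F'.obj X, τ.app X = eqToHom e) :
    ∃ e : F = F', τ = eqToHom e := by
  choose e he using h
  have hF : F = F' := CategoryTheory.Functor.ext e fun X Y f => by
    have := τ.naturality f
    rw [he, he] at this
    rw [← reassoc_of% this, eqToHom_trans, eqToHom_refl, Category.comp_id]
  refine ⟨hF, ?_⟩
  ext X
  rw [he, eqToHom_app]

/-- Bundled lax monoidal functors are equal if and only if the functors are and the identity is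
monoidal. -/
theorem laxMonoidalFunctor_of_eq_iff [MonoidalCategory C] [MonoidalCategory D] {F F' : C ⥤ D}
    [L : F.LaxMonoidal] [L' : F'.LaxMonoidal] :
    LaxMonoidalFunctor.of F = LaxMonoidalFunctor.of F' ↔
      ∃ h : F = F', NatTrans.IsMonoidal (eqToHom h) := by
  constructor
  · intro h
    obtain rfl : F = F' := congrArg LaxMonoidalFunctor.toFunctor h
    obtain rfl : L = L' := by simpa [LaxMonoidalFunctor.of] using h
    exact ⟨rfl, NatTrans.IsMonoidal.id⟩
  · rintro ⟨rfl, h⟩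
    have : L = L' := by
      ext X Y
      · exact (Category.comp_id _).symm.trans h.unit
      · have := h.tensor X Y
        simpa using this
    subst this
    rfl

end EqToHom

/-! ### Uniqueness of the comparison functor -/

open Functor.LaxMonoidal

variable {C : Type u₁} [Category.{v₁} C] [MonoidalCategory C] {M : Center C} [MonObj M]
  {D : Type u₂} [Category.{v₂} D] {G : C ⥤ D} {R : D ⥤ C}

/-- A morphism of modules out of a free module is determined on generators. -/
theorem free_hom_f {A : C} {X : RMod M} (g : freeMod M A ⟶ X) :
    g.f = (freeUnit M A ≫ g.f) ▷ ob M ≫ act X := by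
  have key (k : A ⊗ ob M ⟶ X.A)
      (hk : k ▷ ob M ≫ act X = ((α_ A (ob M) (ob M)).hom ≫ A ◁ mul M) ≫ k) :
      k = (freeUnit M A ≫ k) ▷ ob M ≫ act X := by
    rw [comp_whiskerRight, Category.assoc, hk, Category.assoc, reassoc_of% freeUnit_act]
  exact key g.f (hom_act g)

/-- Objects and morphisms of `C` underlying `K` are prescribed by `R`, so only the actions need
comparison. The counit gives a module morphism from `K (G (R X)) = Free (R X)` to `K X` that is the
identity on generators, and the only such morphism is the action of `K X`. -/
theorem eq_comparison_of_comp_forget_eq (adj : G ⊣ R) (hT : tensorMonad M = adj.toMonad)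
    (K : D ⥤ RMod M) (hR : K ⋙ (tensorMonad M).forget = R)
    (hG : G ⋙ K = (tensorMonad M).free) : K = comparison M adj (eqToHom hT) := by
  subst hR
  have hact (X : D) :
      (eqToHom hT : tensorMonad M ⟶ adj.toMonad).app (K.obj X).A ≫ (K.map (adj.counit.app X)).f =
        act (K.obj X) := by
    let φ : tensorMonad M ⟶ adj.toMonad := eqToHom hT
    let g : freeMod M (K.obj X).A ⟶ K.obj X :=
      eqToHom (Functor.congr_obj hG.symm (K.obj X).A) ≫ K.map (adj.counit.app X)
    have hg : g.f = φ.app (K.obj X).A ≫ (K.map (adj.counit.app X)).f := by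
      refine (Monad.Algebra.comp_f _ _).trans ?_
      -- The first factor of `g` and the component of `φ` are both `eqToHom` between the same
      -- objects, hence equal.
      rw [eqToHom_algebra_f, eqToHom_monad_app]
      rfl
    -- As `φ` preserves monad units, this is a triangle identity of the adjunction.
    have hu : freeUnit M (K.obj X).A ≫ g.f = 𝟙 _ := by
      rw [hg]
      refine (Category.assoc _ _ _).symm.trans ?_
      refine (congrArg (· ≫ (K.map (adj.counit.app X)).f) (φ.app_η (K.obj X).A)).trans ?_
      exact adj.right_triangle_components X
    refine hg.symm.trans ((free_hom_f g).trans ?_)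
    rw [hu, id_whiskerRight, Category.id_comp]
  -- By `hact` the identities of the carriers are linear; the `eqToHom` lemmas turn this
  -- transformation into an equality of functors.
  let τ : K ⟶ comparison M adj (eqToHom hT) :=
    { app X :=
        { f := 𝟙 (K.obj X).A
          h := by
            change 𝟙 (K.obj X).A ▷ ob M ≫ _ ≫ (K.map (adj.counit.app X)).f =
              act (K.obj X) ≫ 𝟙 (K.obj X).A
            rw [id_whiskerRight, Category.comp_id]
            exact (Category.id_comp _).trans (hact X) }
      naturality X Y f := by
        apply Monad.Algebra.Hom.ext'
        exact (Category.comp_id (K.map f).f).trans (Category.id_comp (K.map f).f).symm }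
  exact (exists_eqToHom_of_app_eq_eqToHom τ fun X =>
    exists_eqToHom_of_f_eq_eqToHom _ rfl rfl).1

/-- For a strict equality of monads, `freeToComparison` is itself the equality of functors, so its
monoidality expresses the equality of lax monoidal functors. -/
theorem exists_freeToComparison_eq_eqToHom (adj : G ⊣ R) (hT : tensorMonad M = adj.toMonad) :
    ∃ e : (tensorMonad M).free = G ⋙ comparison M adj (eqToHom hT),
      freeToComparison M adj (eqToHom hT) = eqToHom e :=
  exists_eqToHom_of_app_eq_eqToHom _ fun A =>
    exists_eqToHom_of_f_eq_eqToHom _ _ (eqToHom_monad_app hT A)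

/-! ### The lax monoidal structure of the comparison functor -/

section Comparison

variable [MonoidalCategory D] (adj : G ⊣ R) (φ : tensorMonad M ⟶ adj.toMonad)

/-- The component `A ⊗ M ⟶ R G A` of a morphism of monads. -/
def monadHomApp (A : C) : A ⊗ ob M ⟶ R.obj (G.obj A) := φ.app A

theorem monadHomApp_naturality {A B : C} (f : A ⟶ B) :
    f ▷ ob M ≫ monadHomApp adj φ B = monadHomApp adj φ A ≫ R.map (G.map f) := φ.naturality f

/-- The action `R X ⊗ M ⟶ R G R X ⟶ R X` on the comparison functor. -/
def comparisonAct (X : D) : R.obj X ⊗ ob M ⟶ R.obj X :=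
  monadHomApp adj φ (R.obj X) ≫ R.map (adj.counit.app X)

variable [IsCommMonObj M]

theorem laxT_monadHomApp [G.LaxMonoidal] [R.LaxMonoidal]
    (h : NatTrans.IsMonoidal (monadHomNat M adj φ)) (A B : C) :
    laxT M A B ≫ monadHomApp adj φ (A ⊗ B) =
      (monadHomApp adj φ A ⊗ₘ monadHomApp adj φ B) ≫ μ R _ _ ≫ R.map (μ G A B) :=
  h.tensor A B

/-- On the right, naturality of `φ` moves `μ R X Y` past it and monoidality of `φ` replaces `laxT`
by the tensorators of `R` and `G`. Monoidality of the counit then turns the rest into `R` of a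
tensor product of counits, and naturality of `μ R` finishes. -/
theorem comparisonAct_tensorHom_μ [G.LaxMonoidal] [R.LaxMonoidal]
    (hadj : IsMonoidalAdjunction adj) (h : NatTrans.IsMonoidal (monadHomNat M adj φ)) (X Y : D) :
    (comparisonAct adj φ X ⊗ₘ comparisonAct adj φ Y) ≫ μ R X Y =
      laxT M (R.obj X) (R.obj Y) ≫ μ R X Y ▷ ob M ≫ comparisonAct adj φ (X ⊗ Y) := by
  have hc : μ G (R.obj X) (R.obj Y) ≫ G.map (μ R X Y) ≫ adj.counit.app (X ⊗ Y) =
      adj.counit.app X ⊗ₘ adj.counit.app Y :=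
    (Category.assoc _ _ _).symm.trans
      ((hadj.counit.tensor X Y).trans (Category.comp_id _))
  unfold comparisonAct
  rw [reassoc_of% monadHomApp_naturality adj φ (μ R X Y), reassoc_of% laxT_monadHomApp adj φ h,
    ← R.map_comp, ← R.map_comp, hc, ← tensorHom_comp_tensorHom, Category.assoc]
  exact congrArg _ (μ_natural R _ _)

variable [HasReflexiveCoequalizers C]
  [∀ A : C, Monad.PreservesColimitOfIsReflexivePair (tensorRight A)]
  [∀ A : C, Monad.PreservesColimitOfIsReflexivePair (tensorLeft A)]

attribute [local instance] freeLaxMonoidal forgetLaxMonoidal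

theorem isBilinear_comparison [G.LaxMonoidal] [R.LaxMonoidal] (hadj : IsMonoidalAdjunction adj)
    (h : NatTrans.IsMonoidal (monadHomNat M adj φ)) (X Y : D) :
    IsBilinear (X := (comparison M adj φ).obj X) (Y := (comparison M adj φ).obj Y)
      (Z := (comparison M adj φ).obj (X ⊗ Y)) (μ R X Y) :=
  IsBilinear.of_laxT (comparisonAct_tensorHom_μ adj φ hadj h X Y)

/-- The composite with `Forg` is `R` definitionally, so the `eqToHom` involved is an identity and
its monoidality consists of these equations. -/
theorem of_comparison_comp_forget_eq_iff [R.LaxMonoidal]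
    [L : (comparison M adj φ).LaxMonoidal] :
    LaxMonoidalFunctor.of (comparison M adj φ ⋙ (tensorMonad M).forget) =
        LaxMonoidalFunctor.of R ↔
      one M ≫ L.ε.f = ε R ∧
        ∀ X Y, quo ((comparison M adj φ).obj X) ((comparison M adj φ).obj Y) ≫ (L.μ X Y).f =
          μ R X Y := by
  rw [laxMonoidalFunctor_of_eq_iff]
  constructor
  · rintro ⟨_, h⟩
    exact ⟨(Category.comp_id _).symm.trans h.unit, fun X Y => ((Category.comp_id _).symm.trans
      (h.tensor X Y)).trans ((congrArg (· ≫ μ R X Y) (id_tensorHom_id _ _)).trans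
        (Category.id_comp _))⟩
  · rintro ⟨hε, hμ⟩
    exact ⟨rfl, (Category.comp_id _).trans hε, fun X Y => ((Category.comp_id _).trans
      (hμ X Y)).trans ((congrArg (· ≫ μ R X Y) (id_tensorHom_id _ _)).trans
        (Category.id_comp _)).symm⟩

/-- Existence lifts the structure of `R`; monoidality of `freeToComparison` is tested on `one M` and
`quo`, where it is monoidality of `φ`. -/
theorem existsUnique_laxMonoidal_comparison [G.LaxMonoidal] [R.LaxMonoidal]
    (hadj : IsMonoidalAdjunction adj) (h : NatTrans.IsMonoidal (monadHomNat M adj φ)) :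
    ∃! _L : (comparison M adj φ).LaxMonoidal,
      LaxMonoidalFunctor.of (comparison M adj φ ⋙ (tensorMonad M).forget) =
        LaxMonoidalFunctor.of R ∧
      NatTrans.IsMonoidal (freeToComparison M adj φ) := by
  let LR : (comparison M adj φ ⋙ (tensorMonad M).forget).LaxMonoidal :=
    inferInstanceAs R.LaxMonoidal
  let L : (comparison M adj φ).LaxMonoidal :=
    liftLaxMonoidal (comparison M adj φ) LR (isBilinear_comparison adj φ hadj h)
  have hμ (X Y : D) : quo ((comparison M adj φ).obj X) ((comparison M adj φ).obj Y) ≫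
      (L.μ X Y).f = μ R X Y :=
    quo_liftLaxMonoidal_μ (comparison M adj φ) LR (isBilinear_comparison adj φ hadj h) X Y
  have hε : one M ≫ L.ε.f = ε R :=
    one_liftLaxMonoidal_ε (comparison M adj φ) LR (isBilinear_comparison adj φ hadj h)
  refine ⟨L, ⟨(of_comparison_comp_forget_eq_iff adj φ).2 ⟨hε, hμ⟩, ⟨?_, fun A B => ?_⟩⟩, ?_⟩
  · apply unitObj_hom_ext
    have h₁ : one M ≫ (freeLaxMonoidal (M := M)).ε.f = one M ≫ (λ_ (ob M)).inv := by
      rw [freeLaxMonoidal_ε]; rfl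
    have h₂ : (one M ≫ (λ_ (ob M)).inv) ≫ monadHomApp adj φ (𝟙_ C) = ε R ≫ R.map (ε G) := h.unit
    refine (Category.assoc _ _ _).symm.trans
      ((congrArg (· ≫ monadHomApp adj φ (𝟙_ C)) h₁).trans (h₂.trans ?_))
    exact (congrArg (· ≫ R.map (ε G)) hε.symm).trans (Category.assoc _ _ _)
  · apply tensorObj_hom_ext
    refine (Category.assoc _ _ _).symm.trans
      ((congrArg (· ≫ monadHomApp adj φ (A ⊗ B)) (quo_freeLaxMonoidal_μ A B)).trans
        ((laxT_monadHomApp adj φ h A B).trans ?_))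
    refine Eq.symm ((Category.assoc _ _ _).symm.trans
      ((congrArg (· ≫ _) (quo_tensorHom_f _ _)).trans ((Category.assoc _ _ _).trans ?_)))
    refine congrArg ((monadHomApp adj φ A ⊗ₘ monadHomApp adj φ B) ≫ ·) ?_
    exact (Category.assoc _ _ _).symm.trans
      (congrArg (· ≫ R.map (μ G A B)) (hμ (G.obj A) (G.obj B)))
  -- The condition on `Forg` alone determines the structure, since it fixes the composites with `one
  -- M` and with the epimorphisms `quo`.
  · rintro L' ⟨hL', -⟩
    obtain ⟨hε', hμ'⟩ := (of_comparison_comp_forget_eq_iff adj φ (L := L')).1 hL'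
    apply Functor.LaxMonoidal.ext
    · exact unitObj_hom_ext (hε'.trans hε.symm)
    · funext X Y
      exact tensorObj_hom_ext ((hμ' X Y).trans (hμ X Y).symm)

theorem of_comp_comparison_eq_iff [G.LaxMonoidal] (hT : tensorMonad M = adj.toMonad)
    [(comparison M adj (eqToHom hT)).LaxMonoidal] :
    LaxMonoidalFunctor.of (G ⋙ comparison M adj (eqToHom hT)) =
        LaxMonoidalFunctor.of (tensorMonad M).free ↔
      NatTrans.IsMonoidal (freeToComparison M adj (eqToHom hT)) := by
  obtain ⟨e, he⟩ := exists_freeToComparison_eq_eqToHom adj hT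
  rw [he, eq_comm, laxMonoidalFunctor_of_eq_iff]
  exact ⟨fun ⟨_, h⟩ => h, fun h => ⟨e, h⟩⟩

theorem existsUnique_laxMonoidal_comparison_of_eq [G.LaxMonoidal] [R.LaxMonoidal]
    (hadj : IsMonoidalAdjunction adj) (hT : tensorMonad M = adj.toMonad)
    (h : LaxMonoidalFunctor.of (tensorMonad M).toFunctor = LaxMonoidalFunctor.of (G ⋙ R)) :
    ∃! _L : (comparison M adj (eqToHom hT)).LaxMonoidal,
      LaxMonoidalFunctor.of (comparison M adj (eqToHom hT) ⋙ (tensorMonad M).forget) =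
        LaxMonoidalFunctor.of R ∧
      LaxMonoidalFunctor.of (G ⋙ comparison M adj (eqToHom hT)) =
        LaxMonoidalFunctor.of (tensorMonad M).free := by
  -- This reduces the strict statement to the one for an arbitrary `φ`, taken at `eqToHom hT`; the
  -- equality `h` supplies the monoidality of its underlying transformation.
  simp only [of_comp_comparison_eq_iff]
  apply existsUnique_laxMonoidal_comparison adj _ hadj
  obtain ⟨e, he⟩ := laxMonoidalFunctor_of_eq_iff.1 h
  rw [monadHomNat, eqToHom_toNatTrans]
  exact he

end Comparison

end CentralMonoid

end

open CentralMonoid in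
theorem theoremE {C : Type u₁} [Category.{v₁} C] [MonoidalCategory C]
    [HasReflexiveCoequalizers C]
    [∀ A : C, Monad.PreservesColimitOfIsReflexivePair (tensorRight A)]
    [∀ A : C, Monad.PreservesColimitOfIsReflexivePair (tensorLeft A)]
    (M : Center C) [MonObj M] [IsCommMonObj M] :
    ∃ (_ : (tensorMonad M).free.LaxMonoidal) (_ : (tensorMonad M).forget.LaxMonoidal),
      -- the lax structure of `Free` is the factorization of that of `T_M`; it is strong
      (∀ A B : C, quo ((tensorMonad M).free.obj A) ((tensorMonad M).free.obj B) ≫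
          (Functor.LaxMonoidal.μ (tensorMonad M).free A B).f =
        Functor.LaxMonoidal.μ (tensorMonad M).toFunctor A B) ∧
      (Functor.LaxMonoidal.ε (tensorMonad M).free).f = (λ_ (ob M)).inv ∧
      (∀ A B : C, IsIso (Functor.LaxMonoidal.μ (tensorMonad M).free A B)) ∧
      IsIso (Functor.LaxMonoidal.ε (tensorMonad M).free) ∧
      -- the lax structure of `Forg`
      (∀ X Y : RMod M, Functor.LaxMonoidal.μ (tensorMonad M).forget X Y = quo X Y) ∧
      Functor.LaxMonoidal.ε (tensorMonad M).forget = one M ∧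
      -- the Eilenberg--Moore adjunction is monoidal and satisfies the projection formula
      IsMonoidalAdjunction (tensorMonad M).adj ∧
      ProjectionFormula (tensorMonad M).adj ∧
      -- universal property
      (∀ (D : Type u₂) [Category.{v₂} D] [MonoidalCategory D] (G : C ⥤ D) (R : D ⥤ C)
        (adj : G ⊣ R) [G.LaxMonoidal] [R.LaxMonoidal], IsMonoidalAdjunction adj →
        -- `RG = T_M` strictly, as monads and as lax monoidal functors
        (∀ hT : tensorMonad M = adj.toMonad,
          LaxMonoidalFunctor.of (tensorMonad M).toFunctor = LaxMonoidalFunctor.of (G ⋙ R) →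
          (∀ K : D ⥤ RMod M, K ⋙ (tensorMonad M).forget = R → G ⋙ K = (tensorMonad M).free →
            K = comparison M adj (eqToHom hT)) ∧
          ∃! _L : (comparison M adj (eqToHom hT)).LaxMonoidal,
            LaxMonoidalFunctor.of (comparison M adj (eqToHom hT) ⋙ (tensorMonad M).forget) =
              LaxMonoidalFunctor.of R ∧
            LaxMonoidalFunctor.of (G ⋙ comparison M adj (eqToHom hT)) =
              LaxMonoidalFunctor.of (tensorMonad M).free) ∧
        -- `RG ≅ T_M` as monoidal monads
        (∀ φ : tensorMonad M ≅ adj.toMonad, NatTrans.IsMonoidal (monadHomNat M adj φ.hom) →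
          ∃! _L : (comparison M adj φ.hom).LaxMonoidal,
            LaxMonoidalFunctor.of (comparison M adj φ.hom ⋙ (tensorMonad M).forget) =
              LaxMonoidalFunctor.of R ∧
            NatTrans.IsMonoidal (freeToComparison M adj φ.hom))) := by
  refine ⟨freeLaxMonoidal, forgetLaxMonoidal, quo_freeLaxMonoidal_μ, freeLaxMonoidal_ε,
    freeLaxMonoidal_μ_isIso, freeLaxMonoidal_ε_isIso, fun _ _ => rfl, rfl,
    isMonoidalAdjunction_adj, projectionFormula_adj, ?_⟩
  intro D _ _ G R adj _ _ hadj
  exact ⟨fun hT h => ⟨fun K hR hG => eq_comparison_of_comp_forget_eq adj hT K hR hG,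
    existsUnique_laxMonoidal_comparison_of_eq adj hadj hT h⟩,
    fun φ h => existsUnique_laxMonoidal_comparison adj φ.hom hadj h⟩
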